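/- Let $n\ge 2$, $\mathfrak g=\mathfrak{sl}(n,\mathbb C)$ with its diagonal Cartan subalgebra $\mathfrak h$ and the subalgebras $\mathfrak n_+$, $\mathfrak n_-$ of strictly upper, respectively strictly lower, triangular matrices, and let $\mathfrak L=\mathfrak g[z,z^{-1}]$. Let $C\in\mathfrak g\otimes\mathfrak g$ be the Casimir element with respect to the Killing form, with components $C_{\mathfrak h}\in\mathfrak h\otimes\mathfrak h$ and $C_-\in\mathfrak n_-\otimes\mathfrak n_+$, and put $$r_0(x,y)=\tfrac12 C_{\mathfrak h}+C_-+\frac{1}{(x/y)-1}\,C .$$ Elements $t\in\mathfrak L\otimes\mathfrak L$ are regarded as regular functions $t(x,y)$ on $\mathbb C^*\times\mathbb C^*$ with values in $\mathfrak g\otimes\mathfrak g$, and $r_t(x,y):=r_0(x,y)+t(x,y)$ for $x\neq y$ in $\mathbb C^*$. Let $\delta_0:\mathfrak L\to\mathfrak L\otimes\mathfrak L$ be the standard Lie bialgebra structure, $\delta_0(f)(x,y)=[f(x)\otimes 1+1\otimes f(y),\,r_0(x,y)]$. A classical twist of $\delta_0$ is a skew-symmetric $t\in\mathfrak L\otimes\mathfrak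 L$ with $$[t^{12},t^{13}]+[t^{12},t^{23}]+[t^{13},t^{23}]=\mathrm{Alt}\big((\delta_0\otimes1)t\big),\qquad \mathrm{Alt}(a\otimes b\otimes c)=a\otimes b\otimes c+b\otimes c\otimes a+c\otimes a\otimes b .$$ The functions $r_t$ with $t$ a classical twist of $\delta_0$ are called $\mathrm{id}$-trigonometric $r$-matrices. The functions $r_p$ with $p\in\mathfrak g[z]\otimes\mathfrak g[z]$ that are skew-symmetric, i.e. $r_p(x,y)+\tau(r_p(y,x))=0$ for the flip $\tau$, and solve the classical Yang–Baxter equation $$[r^{12}(x_1,x_2),r^{13}(x_1,x_3)]+[r^{12}(x_1,x_2),r^{23}(x_2,x_3)]+[r^{13}(x_1,x_3),r^{23}(x_2,x_3)]=0$$ (for pairwise distinct $x_1,x_2,x_3\in\mathbb C^*$) are called quasi-trigonometric $r$-matrices. Two such functions $r,s$ are regularly equivalent if there is a regular function $\phi:\mathbb C^*\to\mathrm{Aut}_{\mathbb C\text{-LieAlg}}(\mathfrak g)$ with $s(x,y)=(\phi(x)\otimes\phi(y))\,r(x,y)$ for all $x\neq y$ in $\mathbb C^*$. Then every $\mathrm{id}$-trigonometric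 $r$-matrix is regularly equivalent to a quasi-trigonometric one. -/

import Mathlib

open scoped TensorProduct

noncomputable section

namespace SlLoop

/-! ### Yang-Baxter expressions and classical twists over a complex Lie algebra -/

section General

variable {L : Type*} [LieRing L] [LieAlgebra ℂ L]

/-- The Lie bracket as a bilinear map. -/
def bracket (L : Type*) [LieRing L] [LieAlgebra ℂ L] : L →ₗ[ℂ] L →ₗ[ℂ] L :=
  (LieAlgebra.ad ℂ L : L →ₗ[ℂ] Module.End ℂ L)

/-- `[r¹², s¹³]`, i.e. `(a ⊗ b, c ⊗ d) ↦ [a, c] ⊗ b ⊗ d`. -/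
def lie1213 (r s : L ⊗[ℂ] L) : (L ⊗[ℂ] L) ⊗[ℂ] L :=
  (TensorProduct.assoc ℂ L L L).symm
    (TensorProduct.map₂ (bracket L) (TensorProduct.mk ℂ L L) r s)

/-- `[r¹², s²³]`, i.e. `(a ⊗ b, c ⊗ d) ↦ a ⊗ [b, c] ⊗ d`. -/
def lie1223 (r s : L ⊗[ℂ] L) : (L ⊗[ℂ] L) ⊗[ℂ] L :=
  ((TensorProduct.lift (bracket L)).lTensor L).rTensor L
    ((TensorProduct.assoc ℂ L L L).toLinearMap.rTensor L
      ((TensorProduct.assoc ℂ (L ⊗[ℂ] L) L L).symm (r ⊗ₜ[ℂ] s)))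

/-- `[r¹³, s²³]`, i.e. `(a ⊗ b, c ⊗ d) ↦ a ⊗ c ⊗ [b, d]`. -/
def lie1323 (r s : L ⊗[ℂ] L) : (L ⊗[ℂ] L) ⊗[ℂ] L :=
  TensorProduct.map₂ (TensorProduct.mk ℂ L L) (bracket L) r s

theorem lie1213_tmul (a b c d : L) :
    lie1213 (a ⊗ₜ[ℂ] b) (c ⊗ₜ[ℂ] d) = (⁅a, c⁆ ⊗ₜ[ℂ] b) ⊗ₜ[ℂ] d := rfl

theorem lie1223_tmul (a b c d : L) :
    lie1223 (a ⊗ₜ[ℂ] b) (c ⊗ₜ[ℂ] d) = (a ⊗ₜ[ℂ] ⁅b, c⁆) ⊗ₜ[ℂ] d := rfl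

theorem lie1323_tmul (a b c d : L) :
    lie1323 (a ⊗ₜ[ℂ] b) (c ⊗ₜ[ℂ] d) = (a ⊗ₜ[ℂ] c) ⊗ₜ[ℂ] ⁅b, d⁆ := rfl

/-- `CYB(t) = [t¹², t¹³] + [t¹², t²³] + [t¹³, t²³]`. -/
def CYB (t : L ⊗[ℂ] L) : (L ⊗[ℂ] L) ⊗[ℂ] L :=
  lie1213 t t + lie1223 t t + lie1323 t t

/-- The cyclic permutation `a ⊗ b ⊗ c ↦ b ⊗ c ⊗ a`. -/
def cyc (L : Type*) [LieRing L] [LieAlgebra ℂ L] :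
    (L ⊗[ℂ] L) ⊗[ℂ] L →ₗ[ℂ] (L ⊗[ℂ] L) ⊗[ℂ] L :=
  (TensorProduct.comm ℂ L (L ⊗[ℂ] L)).toLinearMap ∘ₗ (TensorProduct.assoc ℂ L L L).toLinearMap

theorem cyc_tmul (a b c : L) :
    cyc L ((a ⊗ₜ[ℂ] b) ⊗ₜ[ℂ] c) = (b ⊗ₜ[ℂ] c) ⊗ₜ[ℂ] a := rfl

/-- `Alt(a ⊗ b ⊗ c) = a ⊗ b ⊗ c + b ⊗ c ⊗ a + c ⊗ a ⊗ b`. -/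
def Alt (u : (L ⊗[ℂ] L) ⊗[ℂ] L) : (L ⊗[ℂ] L) ⊗[ℂ] L :=
  u + cyc L u + cyc L (cyc L u)

/-- A classical twist of a cobracket `δ`: a skew-symmetric tensor `t` with
`CYB(t) = Alt((δ ⊗ 1) t)`. -/
def IsClassicalTwist (δ : L →ₗ[ℂ] L ⊗[ℂ] L) (t : L ⊗[ℂ] L) : Prop :=
  t + TensorProduct.comm ℂ L L t = 0 ∧ CYB t = Alt (δ.rTensor L t)

/-- The coboundary `dt`, `dt(x) = x · t`, where `x · (a ⊗ b) = [x, a] ⊗ b + a ⊗ [x, b]`. -/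
def coboundary (t : L ⊗[ℂ] L) : L →ₗ[ℂ] L ⊗[ℂ] L where
  toFun x := ⁅x, t⁆
  map_add' x y := add_lie x y t
  map_smul' c x := smul_lie c x t

end General

/-! ### The Lie algebra `𝔤 = 𝔰𝔩(n, ℂ)`, its loop algebra and regular functions -/

/-- `𝔤 = 𝔰𝔩(n, ℂ)`. -/
abbrev G (n : ℕ) : Type := LieAlgebra.SpecialLinear.sl (Fin n) ℂ

/-- The loop algebra `𝔏 = 𝔤 ⊗ ℂ[z, z⁻¹] = 𝔤[z, z⁻¹]`, with the bracket extended from `𝔤`. -/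
def Loop (n : ℕ) : Type := LaurentPolynomial ℂ ⊗[ℂ] G n

instance (n : ℕ) : LieRing (Loop n) :=
  inferInstanceAs (LieRing (LaurentPolynomial ℂ ⊗[ℂ] G n))

instance (n : ℕ) : LieAlgebra ℂ (Loop n) :=
  inferInstanceAs (LieAlgebra ℂ (LaurentPolynomial ℂ ⊗[ℂ] G n))

/-- The identity map `ℂ[z, z⁻¹] ⊗ 𝔤 → 𝔏`. -/
def toLoop (n : ℕ) : LaurentPolynomial ℂ ⊗[ℂ] G n ≃ₗ[ℂ] Loop n :=
  LinearEquiv.refl ℂ (LaurentPolynomial ℂ ⊗[ℂ] G n)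

theorem toLoop_lie {n : ℕ} (p q : LaurentPolynomial ℂ) (a b : G n) :
    ⁅toLoop n (p ⊗ₜ[ℂ] a), toLoop n (q ⊗ₜ[ℂ] b)⁆ = toLoop n ((p * q) ⊗ₜ[ℂ] ⁅a, b⁆) := rfl

/-- The value `f(x) ∈ 𝔤` of `f ∈ 𝔏` at `x ∈ ℂ*`. -/
def ev {n : ℕ} (x : ℂˣ) : Loop n →ₗ[ℂ] G n :=
  (TensorProduct.lid ℂ (G n)).toLinearMap ∘ₗ (LaurentPolynomial.leval ℂ x).rTensor (G n) ∘ₗ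
    (toLoop n).symm.toLinearMap

/-- The value `t(x, y) ∈ 𝔤 ⊗ 𝔤` of `t ∈ 𝔏 ⊗ 𝔏`, with `(f ⊗ g)(x, y) = f(x) ⊗ g(y)`. -/
def ev₂ {n : ℕ} (x y : ℂˣ) : Loop n ⊗[ℂ] Loop n →ₗ[ℂ] G n ⊗[ℂ] G n :=
  TensorProduct.map (ev x) (ev y)

/-- The inclusion `𝔤[z] → 𝔤[z, z⁻¹]`. -/
def polyIncl (n : ℕ) : Polynomial ℂ ⊗[ℂ] G n →ₗ[ℂ] Loop n :=
  (toLoop n).toLinearMap ∘ₗ (Polynomial.toLaurentAlg (R := ℂ)).toLinearMap.rTensor (G n)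

/-- The inclusion `𝔤 → 𝔤[z, z⁻¹]` of the constants. -/
def const (n : ℕ) : G n →ₗ[ℂ] Loop n :=
  (toLoop n).toLinearMap ∘ₗ TensorProduct.mk ℂ (LaurentPolynomial ℂ) (G n) 1

/-! ### The standard structure -/

/-- The projection `a ↦ a - (tr a / n) 1` of `𝔤𝔩(n, ℂ)` onto `𝔰𝔩(n, ℂ)`. -/
def slProj (n : ℕ) : Matrix (Fin n) (Fin n) ℂ →ₗ[ℂ] G n where
  toFun a := ⟨a - (Matrix.trace a / n) • 1, by
    change Matrix.trace (a - (Matrix.trace a / n) • (1 : Matrix (Fin n) (Fin n) ℂ)) = 0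
    rcases n with _ | n
    · simp [Matrix.trace]
    · have : ((n : ℂ) + 1) ≠ 0 := by exact_mod_cast Nat.succ_ne_zero n
      simp
      field_simp
      simp⟩
  map_add' a b := by
    ext1
    simp [add_div, add_smul]
    abel
  map_smul' c a := by
    ext1
    simp [smul_sub, smul_smul, mul_div_assoc]

/-- The image `e i j` in `𝔰𝔩(n, ℂ)` of the matrix unit; this is the matrix unit itself if
`i ≠ j`. -/
def e {n : ℕ} (i j : Fin n) : G n := slProj n (Matrix.single i j 1)

/-- The Casimir element `C ∈ 𝔤 ⊗ 𝔤` with respect to the Killing form `κ(a, b) = 2n tr(ab)`. -/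
def casimir (n : ℕ) : G n ⊗[ℂ] G n :=
  (2 * n : ℂ)⁻¹ • ∑ i : Fin n, ∑ j : Fin n, e i j ⊗ₜ[ℂ] e j i

/-- The component `C_𝔥 ∈ 𝔥 ⊗ 𝔥` of `C`, where `𝔥` consists of the diagonal matrices. -/
def casimirH (n : ℕ) : G n ⊗[ℂ] G n :=
  (2 * n : ℂ)⁻¹ • ∑ i : Fin n, e i i ⊗ₜ[ℂ] e i i

/-- The component `C_- ∈ 𝔫_- ⊗ 𝔫_+` of `C`, where `𝔫_±` consists of the strictly upper,
respectively lower, triangular matrices. -/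
def casimirMinus (n : ℕ) : G n ⊗[ℂ] G n :=
  (2 * n : ℂ)⁻¹ • ∑ i : Fin n, ∑ j : Fin n with j < i, e i j ⊗ₜ[ℂ] e j i

/-- `r₀(x, y) = C_𝔥 / 2 + C_- + C / ((x / y) - 1)` (used for `x ≠ y` only). -/
def r₀ (n : ℕ) (x y : ℂˣ) : G n ⊗[ℂ] G n :=
  (1 / 2 : ℂ) • casimirH n + casimirMinus n + (1 / ((x : ℂ) / y - 1)) • casimir n

/-- The map `z ^ k ↦ (x ^ k - y ^ k) / (x / y - 1)`, written as the Laurent polynomial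
`∑_{0 ≤ j < k} x ^ j y ^ (k - j) - ∑_{k ≤ j < 0} x ^ j y ^ (k - j)`. -/
def divDiff : LaurentPolynomial ℂ →ₗ[ℂ] LaurentPolynomial ℂ ⊗[ℂ] LaurentPolynomial ℂ :=
  (AddMonoidAlgebra.basis ℤ ℂ).constr ℂ fun k : ℤ =>
    ∑ j ∈ Finset.Ico 0 k, LaurentPolynomial.T j ⊗ₜ[ℂ] LaurentPolynomial.T (k - j) -
      ∑ j ∈ Finset.Ico k 0, LaurentPolynomial.T j ⊗ₜ[ℂ] LaurentPolynomial.T (k - j)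

/-- `a ↦ [a ⊗ 1, C]`. -/
def adCasimir (n : ℕ) : G n →ₗ[ℂ] G n ⊗[ℂ] G n where
  toFun a := (LieAlgebra.ad ℂ (G n) a).rTensor (G n) (casimir n)
  map_add' a b := by simp [LinearMap.rTensor_add]
  map_smul' c a := by simp [LinearMap.rTensor_smul]

/-- The standard Lie bialgebra structure `δ₀ : 𝔏 → 𝔏 ⊗ 𝔏`: the cobracket
`δ₀(f)(x, y) = [f(x) ⊗ 1 + 1 ⊗ f(y), r₀(x, y)]`, written out as an element of `𝔏 ⊗ 𝔏`. -/
def δ₀ (n : ℕ) : Loop n →ₗ[ℂ] Loop n ⊗[ℂ] Loop n :=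
  coboundary (TensorProduct.map (const n) (const n)
      ((1 / 2 : ℂ) • casimirH n + casimirMinus n)) +
    TensorProduct.map (toLoop n).toLinearMap (toLoop n).toLinearMap ∘ₗ
      (TensorProduct.tensorTensorTensorComm ℂ (LaurentPolynomial ℂ) (LaurentPolynomial ℂ)
        (G n) (G n)).toLinearMap ∘ₗ
      TensorProduct.map divDiff (adCasimir n) ∘ₗ (toLoop n).symm.toLinearMap

/-! ### `δ₀` is the commutator with `r₀` -/

theorem ev_toLoop_tmul {n : ℕ} (x : ℂˣ) (p : LaurentPolynomial ℂ) (a : G n) :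
    ev x (toLoop n (p ⊗ₜ[ℂ] a)) = p.smeval x • a := rfl

theorem slProj_lie {n : ℕ} (a : G n) (m : Matrix (Fin n) (Fin n) ℂ) :
    ⁅a, slProj n m⁆ = slProj n (a.val * m - m * a.val) := by
  ext1
  rw [LieAlgebra.SpecialLinear.sl_bracket]
  simp [slProj, mul_sub, sub_mul, Matrix.trace_mul_comm a.val m]

theorem lie_e {n : ℕ} (a : G n) (i j : Fin n) :
    ⁅a, e i j⁆ = ∑ k, a.val k i • e k j - ∑ k, a.val j k • e i k := by
  rw [e, slProj_lie, map_sub]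
  congr 1 <;>
  · simp only [e, ← map_smul, ← map_sum]
    congr 1
    ext p q
    simp [Matrix.mul_apply, Matrix.sum_apply, Matrix.single_apply, ite_and]

theorem casimir_invariant {n : ℕ} (a : G n) :
    (LieAlgebra.ad ℂ (G n) a).rTensor (G n) (casimir n) +
      (LieAlgebra.ad ℂ (G n) a).lTensor (G n) (casimir n) = 0 := by
  simp only [casimir, map_smul, map_sum, LinearMap.rTensor_tmul, LinearMap.lTensor_tmul,
    LieAlgebra.ad_apply, lie_e, TensorProduct.sub_tmul, TensorProduct.tmul_sub,
    TensorProduct.sum_tmul, TensorProduct.tmul_sum, Finset.sum_sub_distrib,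
    ← TensorProduct.smul_tmul', TensorProduct.tmul_smul]
  rw [← smul_add]
  have h1 : ∑ x : Fin n, ∑ y, ∑ k, a.val k x • e k y ⊗ₜ[ℂ] e y x =
      ∑ x : Fin n, ∑ y, ∑ k, a.val x k • e x y ⊗ₜ[ℂ] e y k := by
    rw [Finset.sum_congr rfl fun x _ => Finset.sum_comm, Finset.sum_comm]
    exact Finset.sum_congr rfl fun x _ => Finset.sum_comm
  have h2 : ∑ x : Fin n, ∑ y, ∑ k, a.val y k • e x k ⊗ₜ[ℂ] e y x =
      ∑ x : Fin n, ∑ y, ∑ k, a.val k y • e x y ⊗ₜ[ℂ] e k x :=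
    Finset.sum_congr rfl fun x _ => Finset.sum_comm
  rw [h1, h2]
  simp

theorem divDiff_T (k : ℤ) : divDiff (LaurentPolynomial.T k) =
    ∑ j ∈ Finset.Ico 0 k, LaurentPolynomial.T j ⊗ₜ[ℂ] LaurentPolynomial.T (k - j) -
      ∑ j ∈ Finset.Ico k 0, LaurentPolynomial.T j ⊗ₜ[ℂ] LaurentPolynomial.T (k - j) := by
  have : (LaurentPolynomial.T k : LaurentPolynomial ℂ) = AddMonoidAlgebra.basis ℤ ℂ k := by
    rw [AddMonoidAlgebra.basis_apply]; rfl
  rw [this, divDiff, Module.Basis.constr_basis]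

theorem geom_zpow (x y : ℂˣ) (hxy : x ≠ y) (k : ℤ) :
    ∑ j ∈ Finset.Ico 0 k, (x : ℂ) ^ j * (y : ℂ) ^ (k - j) -
      ∑ j ∈ Finset.Ico k 0, (x : ℂ) ^ j * (y : ℂ) ^ (k - j) =
    ((x : ℂ) ^ k - (y : ℂ) ^ k) * (1 / ((x : ℂ) / y - 1)) := by
  have hx : (x : ℂ) ≠ 0 := x.ne_zero
  have hy : (y : ℂ) ≠ 0 := y.ne_zero
  have hne : (x : ℂ) / y - 1 ≠ 0 := by
    rw [sub_ne_zero, Ne, div_eq_one_iff_eq hy]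
    exact fun h => hxy (Units.ext h)
  rw [mul_one_div, eq_div_iff hne]
  have key : ∀ j : ℤ, (x : ℂ) ^ j * (y : ℂ) ^ (k - j) * (x / y - 1) =
      (x : ℂ) ^ (j + 1) * (y : ℂ) ^ (k - (j + 1)) - (x : ℂ) ^ j * (y : ℂ) ^ (k - j) := by
    intro j
    rw [zpow_add_one₀ hx, ← sub_sub, zpow_sub_one₀ hy]
    field_simp
  rw [sub_mul, Finset.sum_mul, Finset.sum_mul, Finset.sum_congr rfl fun j _ => key j,
    Finset.sum_congr (s₁ := Finset.Ico k 0) rfl fun j _ => key j]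
  have tele : ∀ (F : ℤ → ℂ) (a : ℤ) (m : ℕ),
      ∑ j ∈ Finset.Ico a (a + m), (F (j + 1) - F j) = F (a + m) - F a := by
    intro F a m
    induction m with
    | zero => simp
    | succ m ih =>
      rw [Nat.cast_succ, ← add_assoc, ← Order.succ_eq_add_one (a + (m : ℤ)),
        ← Finset.insert_Ico_right_eq_Ico_succ (by simp), Finset.sum_insert (by simp), ih,
        Order.succ_eq_add_one]
      ring
  rcases le_total 0 k with h | h
  · obtain ⟨m, rfl⟩ := Int.eq_ofNat_of_zero_le h
    have := tele (fun j => (x : ℂ) ^ j * (y : ℂ) ^ ((m : ℤ) - j)) 0 m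
    rw [zero_add] at this
    rw [this]
    simp
  · obtain ⟨m, hm⟩ := Int.eq_ofNat_of_zero_le (neg_nonneg.mpr h)
    have := tele (fun j => (x : ℂ) ^ j * (y : ℂ) ^ (k - j)) k m
    rw [← hm, add_neg_cancel] at this
    rw [this]
    simp [h]

theorem smeval_mul (x : ℂˣ) (p q : LaurentPolynomial ℂ) :
    (p * q).smeval x = p.smeval x * q.smeval x := by
  induction p using LaurentPolynomial.induction_on' with
  | add p₁ p₂ h₁ h₂ => simp [add_mul, h₁, h₂]
  | C_mul_T k c =>
    induction q using LaurentPolynomial.induction_on' with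
    | add p₁ p₂ h₁ h₂ => simp [mul_add, h₁, h₂]
    | C_mul_T l d =>
      rw [mul_mul_mul_comm, ← LaurentPolynomial.T_add, ← map_mul]
      simp only [LaurentPolynomial.smeval_C_mul_T_n, zpow_add, Units.val_mul, smul_eq_mul]
      ring

theorem loop_induction {n : ℕ} {P : Loop n → Prop} (f : Loop n) (h0 : P 0)
    (ht : ∀ p a, P (toLoop n (p ⊗ₜ[ℂ] a))) (hadd : ∀ f g, P f → P g → P (f + g)) : P f := by
  obtain ⟨f, rfl⟩ := (toLoop n).surjective f
  induction f using TensorProduct.induction_on with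
  | zero => simpa using h0
  | tmul p a => exact ht p a
  | add f g hf hg =>
    rw [map_add]
    exact hadd _ _ hf hg

theorem ev_lie {n : ℕ} (x : ℂˣ) (f g : Loop n) : ev x ⁅f, g⁆ = ⁅ev x f, ev x g⁆ := by
  refine loop_induction (P := fun f => ev x ⁅f, g⁆ = ⁅ev x f, ev x g⁆) f (by simp)
    (fun p a => ?_) (fun f₁ f₂ h₁ h₂ => by simp [h₁, h₂])
  refine loop_induction (P := fun g => ev x ⁅toLoop n (p ⊗ₜ[ℂ] a), g⁆ =
    ⁅ev x (toLoop n (p ⊗ₜ[ℂ] a)), ev x g⁆) g (by simp)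
    (fun q b => ?_) (fun f₁ f₂ h₁ h₂ => by simp [h₁, h₂])
  rw [toLoop_lie, ev_toLoop_tmul, ev_toLoop_tmul, ev_toLoop_tmul, smeval_mul]
  simp [smul_smul, mul_comm]

theorem ev₂_coboundary {n : ℕ} (x y : ℂˣ) (f : Loop n) (t : Loop n ⊗[ℂ] Loop n) :
    ev₂ x y (coboundary t f) = (LieAlgebra.ad ℂ (G n) (ev x f)).rTensor (G n) (ev₂ x y t) +
      (LieAlgebra.ad ℂ (G n) (ev y f)).lTensor (G n) (ev₂ x y t) := by
  change ev₂ x y ⁅f, t⁆ = _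
  induction t using TensorProduct.induction_on with
  | zero => simp
  | add s t hs ht =>
    simp only [lie_add, map_add, hs, ht]
    abel
  | tmul g h => simp [ev₂, ev_lie]

/-- `δ₀(f)(x, y) = [f(x) ⊗ 1 + 1 ⊗ f(y), r₀(x, y)]`. -/
theorem ev₂_δ₀ {n : ℕ} (f : Loop n) (x y : ℂˣ) (hxy : x ≠ y) :
    ev₂ x y (δ₀ n f) = (LieAlgebra.ad ℂ (G n) (ev x f)).rTensor (G n) (r₀ n x y) +
      (LieAlgebra.ad ℂ (G n) (ev y f)).lTensor (G n) (r₀ n x y) := by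
  have hone : ∀ z : ℂˣ, ev z ∘ₗ const n =
      LinearMap.id := by
    intro z
    ext1 a
    simp [const, ev_toLoop_tmul]
  have hc : ∀ t : G n ⊗[ℂ] G n,
      ev₂ x y (TensorProduct.map (const n) (const n) t) = t := by
    intro t
    rw [ev₂, ← LinearMap.comp_apply, ← TensorProduct.map_comp, hone, hone,
      TensorProduct.map_id, LinearMap.id_apply]
  have hcomm : ∀ (u : LaurentPolynomial ℂ ⊗[ℂ] LaurentPolynomial ℂ) (w : G n ⊗[ℂ] G n),
      ev₂ x y (TensorProduct.map (toLoop n).toLinearMap (toLoop n).toLinearMap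
        (TensorProduct.tensorTensorTensorComm ℂ (LaurentPolynomial ℂ)
          (LaurentPolynomial ℂ) (G n) (G n) (u ⊗ₜ[ℂ] w))) =
      (LinearMap.mul' ℂ ℂ (TensorProduct.map (LaurentPolynomial.leval ℂ x)
        (LaurentPolynomial.leval ℂ y) u)) • w := by
    intro u w
    induction u using TensorProduct.induction_on with
    | zero => simp
    | add u₁ u₂ h₁ h₂ => simp only [TensorProduct.add_tmul, map_add, h₁, h₂, add_smul]
    | tmul p q =>
      induction w using TensorProduct.induction_on with
      | zero => simp
      | add w₁ w₂ h₁ h₂ => simp only [TensorProduct.tmul_add, map_add, h₁, h₂, smul_add]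
      | tmul a b =>
        simp [ev₂, ev_toLoop_tmul, TensorProduct.smul_tmul', TensorProduct.tmul_smul, smul_smul, mul_comm]
  refine loop_induction (P := fun f => ev₂ x y (δ₀ n f) =
    (LieAlgebra.ad ℂ (G n) (ev x f)).rTensor (G n) (r₀ n x y) +
      (LieAlgebra.ad ℂ (G n) (ev y f)).lTensor (G n) (r₀ n x y)) f (by simp)
    (fun p a => ?_) (fun f₁ f₂ h₁ h₂ => ?_)
  · induction p using LaurentPolynomial.induction_on' with
    | add p q hp hq =>
      simp only [TensorProduct.add_tmul, map_add, hp, hq, LinearMap.rTensor_add,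
        LinearMap.lTensor_add, LinearMap.add_apply]
      abel
    | C_mul_T k c =>
      rw [← LaurentPolynomial.smul_eq_C_mul, ← TensorProduct.smul_tmul']
      simp only [map_smul, LinearMap.rTensor_smul, LinearMap.lTensor_smul, LinearMap.smul_apply,
        ← smul_add]
      congr 1
      have hl := eq_neg_of_add_eq_zero_right (casimir_invariant a)
      have hD : ev₂ x y (TensorProduct.map (toLoop n).toLinearMap (toLoop n).toLinearMap
          (TensorProduct.tensorTensorTensorComm ℂ (LaurentPolynomial ℂ)
          (LaurentPolynomial ℂ) (G n) (G n) (divDiff (LaurentPolynomial.T k) ⊗ₜ[ℂ]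
            adCasimir n a))) = (((x : ℂ) ^ k - (y : ℂ) ^ k) * (1 / ((x : ℂ) / y - 1))) •
              (LieAlgebra.ad ℂ (G n) a).rTensor (G n) (casimir n) := by
        rw [hcomm, divDiff_T, ← geom_zpow x y hxy]
        simp [adCasimir]
      rw [δ₀, LinearMap.add_apply, map_add, ev₂_coboundary, hc]
      simp only [LinearMap.comp_apply, LinearEquiv.coe_coe, LinearEquiv.symm_apply_apply,
        TensorProduct.map_tmul]
      rw [hD]
      simp only [ev_toLoop_tmul, r₀, map_add, map_smul, LinearMap.rTensor_smul,
        LinearMap.lTensor_smul, LinearMap.smul_apply, hl, LaurentPolynomial.smeval_T_pow,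
        Units.val_zpow_eq_zpow_val]
      module
  · simp only [map_add, h₁, h₂, LinearMap.rTensor_add, LinearMap.lTensor_add, LinearMap.add_apply]
    abel

/-! ### `r`-matrices -/

/-- `r_t = r₀ + t` for `t ∈ 𝔏 ⊗ 𝔏`. -/
def rMatrix {n : ℕ} (t : Loop n ⊗[ℂ] Loop n) (x y : ℂˣ) : G n ⊗[ℂ] G n :=
  r₀ n x y + ev₂ x y t

/-- `r` solves the classical Yang-Baxter equation with two spectral parameters. -/
def SolvesCYBE {n : ℕ} (r : ℂˣ → ℂˣ → G n ⊗[ℂ] G n) : Prop :=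
  ∀ x₁ x₂ x₃ : ℂˣ, x₁ ≠ x₂ → x₁ ≠ x₃ → x₂ ≠ x₃ →
    lie1213 (r x₁ x₂) (r x₁ x₃) + lie1223 (r x₁ x₂) (r x₂ x₃) +
      lie1323 (r x₁ x₃) (r x₂ x₃) = 0

/-- `r(x, y) + τ(r(y, x)) = 0`. -/
def IsSkew {n : ℕ} (r : ℂˣ → ℂˣ → G n ⊗[ℂ] G n) : Prop :=
  ∀ x y : ℂˣ, x ≠ y → r x y + TensorProduct.comm ℂ (G n) (G n) (r y x) = 0

/-- `id`-trigonometric `r`-matrices: `r = r₀ + t` off the diagonal, where `t` is a classical twist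
of the standard structure `δ₀` on `𝔏`. -/
def IsIdTrigonometric {n : ℕ} (r : ℂˣ → ℂˣ → G n ⊗[ℂ] G n) : Prop :=
  ∃ t : Loop n ⊗[ℂ] Loop n, IsClassicalTwist (δ₀ n) t ∧ ∀ x y, x ≠ y → r x y = rMatrix t x y

/-- Quasi-trigonometric `r`-matrices: skew-symmetric solutions of the classical Yang-Baxter
equation of the form `r = r₀ + p` off the diagonal, where `p ∈ 𝔤[z] ⊗ 𝔤[z]`. -/
def IsQuasiTrigonometric {n : ℕ} (r : ℂˣ → ℂˣ → G n ⊗[ℂ] G n) : Prop :=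
  IsSkew r ∧ SolvesCYBE r ∧
    ∃ p : (Polynomial ℂ ⊗[ℂ] G n) ⊗[ℂ] (Polynomial ℂ ⊗[ℂ] G n),
      ∀ x y, x ≠ y → r x y = rMatrix (TensorProduct.map (polyIncl n) (polyIncl n) p) x y

/-- A regular function `φ : ℂ* → Aut(𝔤)`: for each `a ∈ 𝔤` the function `z ↦ φ(z) a` is given by
an element of `𝔤[z, z⁻¹]`. -/
structure RegularEquivalence (n : ℕ) where
  toFun : ℂˣ → (G n ≃ₗ⁅ℂ⁆ G n)
  regular : ∀ a : G n, ∃ f : Loop n, ∀ z : ℂˣ, toFun z a = ev z f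

/-- `r` and `s` are regularly equivalent: there is a regular `φ : ℂ* → Aut(𝔤)` with
`s(x, y) = (φ(x) ⊗ φ(y)) r(x, y)` for all `x ≠ y`. -/
def RegularlyEquivalent {n : ℕ} (r s : ℂˣ → ℂˣ → G n ⊗[ℂ] G n) : Prop :=
  ∃ φ : RegularEquivalence n, ∀ x y : ℂˣ, x ≠ y →
    s x y = TensorProduct.map (φ.toFun x).toLinearEquiv.toLinearMap
      (φ.toFun y).toLinearEquiv.toLinearMap (r x y)

end SlLoop

end

open scoped TensorProduct

noncomputable section

namespace SlLoop

/-! ### Integrality of eigenvalues -/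

section Integrality

open Matrix Polynomial

/-! Expand `r₀ + t` at `y = ∞`, that is in nonnegative powers of `u = x / y`, and contract the
second factor with the form `res κ(f, g) dz / z`. This gives an operator `R = rOp t` on the loop
algebra. The twist equation says exactly what is needed for the Rota–Baxter identity `[Rg, Rh] =
R([g, Rh] + [Rg, h] + [g, h])` (`rOp_lie`), so the range `W` of `R` is a Lie subalgebra. Since `t`
is a finite sum of pure tensors, `W` lies in `z ^ (-m) 𝔤[z]` and contains `z ^ M 𝔤` for some large
`M`.

The core is that such a `W` can be conjugated into `𝔤[z]` by some `P ∈ GL_n(ℂ[z, z⁻¹])`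
(`exists_conj_polynomial`). For `x ∈ W` the iterates of `ad x` on `z ^ M E_ij` stay in a fixed
finitely generated `ℂ[z]`-module, which forces the differences of eigenvalues of `x` to be integral
over `ℂ[z]`. The trace is zero, so the eigenvalues themselves are integral, and the characteristic
polynomial has coefficients in `ℂ[z]`. By Cayley–Hamilton `w ^ n` is then a `ℂ[z]`-combination of
lower powers for each `w ∈ W`. Products of `n` elements of `W` reduce to `n`-th powers and shorter
products by polarization, because `W` is closed under commutators. Therefore the `ℂ[z]`-span of
products of at most `n - 1` elements is stable under left multiplication by `W`. The columns of its
members span a `W`-stable lattice in `ℂ[z, z⁻¹]^n`, and a basis of this lattice supplies `P`.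

Let `φ` be conjugation by `P` and gauge `r_t` by it. Split `r_t` into a partial sum of its expansion
up to order `K` and the tail `u ^ K / (u - 1) · C`. The contractions of the partial sum lie in `W`,
so after gauging it is polynomial in the first variable. The gauged tail differs from the tail by a
multiple of `(φ(x) ⊗ φ(y)) C - C`, which vanishes on the diagonal; the pole cancels, and for large
`K` the result is polynomial in `x`. Thus the gauged function is `r₀ + u` with `u` polynomial in the
first variable, and skew-symmetry of `u` gives the second (`exists_gauged_twist`,
`eq_map_polyIncl`). Skew-symmetry and the Yang–Baxter equation hold for `r_t` (`rMatrix_isSkew`,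
`rMatrix_solvesCYBE`) and survive pointwise automorphisms. -/

theorem exists_eigenvector_of_isRoot {K ι : Type*} [Field K] [Fintype ι] [DecidableEq ι]
    {x : Matrix ι ι K} {a : K} (ha : x.charpoly.IsRoot a) :
    (∃ v, v ≠ 0 ∧ x *ᵥ v = a • v) ∧ ∃ w, w ≠ 0 ∧ w ᵥ* x = a • w := by
  have hdet : (scalar ι a - x).det = 0 := by rw [← eval_charpoly]; exact ha
  constructor
  · obtain ⟨v, hv, h⟩ := exists_mulVec_eq_zero_iff.mpr hdet
    refine ⟨v, hv, ?_⟩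
    rw [sub_mulVec, sub_eq_zero] at h
    rw [← h]
    ext i
    simp [scalar_apply, mulVec_diagonal]
  · obtain ⟨v, hv, h⟩ := exists_vecMul_eq_zero_iff.mpr hdet
    refine ⟨v, hv, ?_⟩
    rw [vecMul_sub, sub_eq_zero] at h
    rw [← h]
    ext i
    simp [scalar_apply, vecMul_diagonal, mul_comm]

/-- With `v` a right eigenvector for `a` and `w` a left eigenvector for `b`, the functional `y ↦ w y
v` turns `ad x` into multiplication by `b - a`. The iterates of `ad x` on a matrix unit therefore
become the elements `(b - a) ^ m * c`, all in the finitely generated image of `F`; choosing the unit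
where `w i` and `v j` are nonzero makes `c ≠ 0`. -/
theorem isIntegral_root_sub_root {S K ι : Type*} [CommRing S] [IsNoetherianRing S] [Field K]
    [Algebra S K] [IsDomain S] [Fintype ι] [DecidableEq ι] {x : Matrix ι ι K}
    {F : Submodule S (Matrix ι ι K)} (hF : F.FG) {d : K} (hd : d ≠ 0)
    (h : ∀ (m : ℕ) (i j : ι), (fun y => x * y - y * x)^[m] (d • single i j 1) ∈ F)
    {a b : K} (ha : x.charpoly.IsRoot a) (hb : x.charpoly.IsRoot b) : IsIntegral S (b - a) := by
  obtain ⟨v, hv, hxv⟩ := (exists_eigenvector_of_isRoot ha).1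
  obtain ⟨w, hw, hwx⟩ := (exists_eigenvector_of_isRoot hb).2
  obtain ⟨j, hj⟩ := Function.ne_iff.mp hv
  obtain ⟨i, hi⟩ := Function.ne_iff.mp hw
  let ψ : Matrix ι ι K →ₗ[S] K :=
    { toFun := fun y => w ⬝ᵥ (y *ᵥ v)
      map_add' := fun y z => by simp [add_mulVec, dotProduct_add]
      map_smul' := fun c y => by simp [smul_mulVec, dotProduct_smul] }
  have hψ : ∀ y, ψ (x * y - y * x) = (b - a) * ψ y := by
    intro y
    change w ⬝ᵥ ((x * y - y * x) *ᵥ v) = (b - a) * (w ⬝ᵥ (y *ᵥ v))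
    rw [sub_mulVec, dotProduct_sub, ← mulVec_mulVec, ← mulVec_mulVec, dotProduct_mulVec w x, hwx,
      hxv, mulVec_smul, smul_dotProduct, dotProduct_smul, smul_eq_mul, smul_eq_mul, sub_mul]
  set c : K := ψ (d • single i j 1) with hc
  have hc0 : c ≠ 0 := by
    have : c = d * (w i * v j) := by
      change w ⬝ᵥ ((d • single i j (1 : K)) *ᵥ v) = _
      rw [smul_mulVec, dotProduct_smul, smul_eq_mul, single_mulVec]
      congr 1
      rw [dotProduct, Finset.sum_eq_single i] <;> simp +contextual [Function.update_of_ne]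
    rw [this]
    exact mul_ne_zero hd (mul_ne_zero hi hj)
  have hpow : ∀ m : ℕ, ψ ((fun y => x * y - y * x)^[m] (d • single i j 1)) = (b - a) ^ m * c := by
    intro m
    induction m with
    | zero => simp [hc]
    | succ m ih => rw [Function.iterate_succ_apply', hψ, ih, pow_succ']; ring
  -- The image of `F` need not be stable under `b - a`, whereas this span is; it is finitely
  -- generated because `S` is Noetherian.
  let N : Submodule S K := Submodule.span S (Set.range fun m : ℕ => (b - a) ^ m * c)
  have hN : N ≤ F.map ψ := by
    rw [Submodule.span_le]
    rintro _ ⟨m, rfl⟩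
    exact ⟨_, h m i j, hpow m⟩
  have hNfg : N.FG := by
    have : IsNoetherian S (F.map ψ) := isNoetherian_of_fg_of_noetherian _ (hF.map ψ)
    exact isNoetherian_submodule.mp this N hN
  refine isIntegral_of_smul_mem_submodule N ?_ hNfg (b - a) ?_
  · rw [Submodule.ne_bot_iff]
    exact ⟨c, Submodule.subset_span ⟨0, by simp⟩, hc0⟩
  · intro y hy
    induction hy using Submodule.span_induction with
    | mem y hy =>
      obtain ⟨m, rfl⟩ := hy
      exact Submodule.subset_span ⟨m + 1, by simp [pow_succ', mul_assoc]⟩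
    | zero => simp
    | add y z _ _ hy hz => rw [smul_add]; exact N.add_mem hy hz
    | smul s y _ hy => rw [smul_comm]; exact N.smul_mem s hy

/-- Summing `a - b` over all roots `b` gives `n * a` because the trace vanishes. As `n` is a unit in
`S`, integrality of differences gives integrality of each root. -/
theorem isIntegral_coeff_charpoly {S K ι : Type*} [CommRing S] [IsNoetherianRing S] [Field K]
    [IsAlgClosed K] [Algebra S K] [IsDomain S] [Fintype ι] [DecidableEq ι] {x : Matrix ι ι K}
    (hx : x.trace = 0) (hcard : IsUnit (Fintype.card ι : S))
    {F : Submodule S (Matrix ι ι K)} (hF : F.FG) {d : K} (hd : d ≠ 0)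
    (h : ∀ (m : ℕ) (i j : ι), (fun y => x * y - y * x)^[m] (d • single i j 1) ∈ F) (k : ℕ) :
    IsIntegral S (x.charpoly.coeff k) := by
  have hsplit := IsAlgClosed.splits x.charpoly
  refine isIntegral_coeff_of_factors x.charpoly ?_ hsplit ?_ k
  · rw [x.charpoly_monic.leadingCoeff]; exact isIntegral_one
  intro a ha
  have ha' : x.charpoly.IsRoot a := ha
  have hsum : ((x.charpoly.roots.map fun b => a - b).sum) = (Fintype.card ι : K) * a := by
    rw [Multiset.sum_map_sub, Multiset.map_id', ← trace_eq_sum_roots_charpoly, hx,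
      Multiset.map_const', Multiset.sum_replicate, ← hsplit.natDegree_eq_card_roots,
      x.charpoly_natDegree_eq_dim]
    simp
  have hint : IsIntegral S ((Fintype.card ι : K) * a) := by
    rw [← hsum]
    refine IsIntegral.multiset_sum ?_
    intro c hc
    obtain ⟨b, hb, rfl⟩ := Multiset.mem_map.mp hc
    exact isIntegral_root_sub_root hF hd h (isRoot_of_mem_roots hb) ha'
  obtain ⟨u, hu⟩ := hcard
  have : a = algebraMap S K (↑u⁻¹ : S) * ((Fintype.card ι : K) * a) := by
    rw [← mul_assoc, ← map_natCast (algebraMap S K), ← hu, ← map_mul]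
    simp
  rw [this]
  exact isIntegral_algebraMap.mul hint

/-- Laurent polynomials embed into the fraction field of `ℂ[X]`, and `ℂ[X]` is integrally closed
there. -/
instance isIntegrallyClosedIn_laurentPolynomial :
    IsIntegrallyClosedIn ℂ[X] (LaurentPolynomial ℂ) := by
  have hunit : ∀ y : Submonoid.powers (X : ℂ[X]),
      IsUnit (algebraMap ℂ[X] (FractionRing ℂ[X]) y) := by
    rintro ⟨_, k, rfl⟩
    rw [isUnit_iff_ne_zero, Ne, FaithfulSMul.algebraMap_eq_zero_iff]
    exact pow_ne_zero k X_ne_zero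
  let f : LaurentPolynomial ℂ →ₐ[ℂ[X]] FractionRing ℂ[X] :=
    { IsLocalization.lift (M := Submonoid.powers (X : ℂ[X])) hunit with
      commutes' := fun q => IsLocalization.lift_eq hunit q }
  have hf : Function.Injective f := by
    refine (IsLocalization.lift_injective_iff hunit).mpr fun p q => ?_
    rw [LaurentPolynomial.algebraMap_eq_toLaurent, LaurentPolynomial.algebraMap_eq_toLaurent,
      toLaurent_inj, (IsFractionRing.injective ℂ[X] (FractionRing ℂ[X])).eq_iff]
  have := (isIntegrallyClosed_iff_isIntegrallyClosedIn (R := ℂ[X]) (FractionRing ℂ[X])).mp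
    inferInstance
  exact f.isIntegrallyClosedIn hf this

end Integrality

/-! ### Products of elements of a commutator-closed subspace -/

section Polarization

open Polynomial

/-- A functional on the quotient by `U` turns the curve into a complex polynomial vanishing at every
`c`, hence zero; functionals separate points of the quotient. -/
theorem mem_of_forall_sum_pow_smul_mem {V : Type*} [AddCommGroup V] [Module ℂ V]
    (U : Submodule ℂ V) (N : ℕ) (v : ℕ → V)
    (h : ∀ c : ℂ, ∑ i ∈ Finset.range N, c ^ i • v i ∈ U) {i : ℕ} (hi : i < N) : v i ∈ U := by
  rw [← Submodule.Quotient.mk_eq_zero, ← Submodule.mkQ_apply,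
    ← Module.forall_dual_apply_eq_zero_iff ℂ]
  intro f
  have hp : ∑ k ∈ Finset.range N, C (f (U.mkQ (v k))) * X ^ k = (0 : ℂ[X]) := by
    refine Polynomial.funext fun c => ?_
    have := (Submodule.Quotient.mk_eq_zero U).mpr (h c)
    rw [← Submodule.mkQ_apply] at this
    have := congrArg f this
    simp only [map_sum, map_smul, smul_eq_mul, map_zero] at this
    simp only [eval_finsetSum, eval_mul, eval_C, eval_pow, eval_X, eval_zero, ← this, mul_comm]
  have := congrArg (fun p => coeff p i) hp
  simpa [finsetSum_coeff, coeff_C_mul, coeff_X_pow, hi] using this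

variable {A : Type*} [Ring A] [Algebra ℂ A] {W : Submodule ℂ A}

theorem mem_one_sup_pow {x : A} (hx : x ∈ W) (k : ℕ) : x ^ k ∈ (1 ⊔ W) ^ k :=
  Submodule.pow_mem_pow _ (Submodule.mem_sup_right hx) k

theorem one_sup_pow_mono {j k : ℕ} (h : j ≤ k) : (1 ⊔ W) ^ j ≤ (1 ⊔ W) ^ k :=
  pow_le_pow_right' le_sup_left h

/-- Moving `x` to the left past one `w` costs a commutator, which lies in `W` and so shortens the
product by one factor. -/
theorem pow_mul_mul_pow_sub_mem (hW : ∀ x ∈ W, ∀ y ∈ W, x * y - y * x ∈ W) {w x : A} (hw : w ∈ W)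
    (hx : x ∈ W) (j l : ℕ) : w ^ j * x * w ^ l - x * w ^ (j + l) ∈ (1 ⊔ W) ^ (j + l) := by
  induction j generalizing l with
  | zero => simp
  | succ j ih =>
    have h1 := ih (l + 1)
    have h2 : w ^ j * (w * x - x * w) * w ^ l ∈ (1 ⊔ W) ^ (j + 1 + l) := by
      rw [pow_add, pow_succ]
      exact Submodule.mul_mem_mul (Submodule.mul_mem_mul (mem_one_sup_pow hw j)
        (Submodule.mem_sup_right (hW w hw x hx))) (mem_one_sup_pow hw l)
    rw [← add_assoc, add_right_comm] at h1
    convert! add_mem h2 h1 using 1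
    rw [pow_succ w j, pow_succ' w l]
    noncomm_ring

/-- The linear coefficient of `(w + x X) ^ (k + 1)` is the sum of all `w ^ j x w ^ (k - j)`, which
is `(k + 1) x w ^ k` up to shorter products. It also lies in the span of `(k + 1)`-th powers, since
every value `(w + c x) ^ (k + 1)` does. -/
theorem mul_pow_mem (hW : ∀ x ∈ W, ∀ y ∈ W, x * y - y * x ∈ W) {w x : A} (hw : w ∈ W)
    (hx : x ∈ W) (k : ℕ) :
    x * w ^ k ∈ Submodule.span ℂ {y | ∃ u ∈ W, y = u ^ (k + 1)} ⊔ (1 ⊔ W) ^ k := by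
  set U := Submodule.span ℂ {y | ∃ u ∈ W, y = u ^ (k + 1)}
  have hcoeff : ∀ k : ℕ, ((C w + C x * X) ^ (k + 1) : A[X]).coeff 0 = w ^ (k + 1) ∧
      ((C w + C x * X) ^ (k + 1) : A[X]).coeff 1 - (k + 1 : ℂ) • (x * w ^ k) ∈ (1 ⊔ W) ^ k := by
    intro k
    induction k with
    | zero => simp
    | succ k ih =>
      obtain ⟨h0, h1⟩ := ih
      rw [pow_succ _ (k + 1), mul_add, ← mul_assoc]
      refine ⟨by rw [coeff_add, coeff_mul_C, h0, coeff_mul_X_zero, add_zero, ← pow_succ], ?_⟩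
      rw [coeff_add, coeff_mul_C, coeff_mul_X, coeff_mul_C, h0]
      have h2 := pow_mul_mul_pow_sub_mem hW hw hx (k + 1) 0
      have h3 := Submodule.mul_mem_mul h1 (Submodule.mem_sup_right hw : w ∈ 1 ⊔ W)
      rw [← pow_succ] at h3
      convert! add_mem h3 h2 using 1
      push_cast
      rw [sub_mul, smul_mul_assoc, mul_assoc x, ← pow_succ, add_smul (_ + 1 : ℂ) 1, one_smul]
      simp only [pow_zero, mul_one, add_zero]
      abel
  set p : A[X] := (C w + C x * X) ^ (k + 1) with hp
  -- The bound `natDegree + 2` keeps index `1` in range even when `p` is constant.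
  have heval : ∀ c : ℂ, ∑ i ∈ Finset.range (p.natDegree + 2), c ^ i • p.coeff i =
      (w + c • x) ^ (k + 1) := by
    intro c
    let φ := eval₂RingHom' (RingHom.id A) (algebraMap ℂ A c) fun a => Algebra.commutes' c a |>.symm
    have h1 : φ p = (w + c • x) ^ (k + 1) := by
      rw [hp, map_pow, map_add, map_mul]
      congr 2
      · exact eval₂_C _ _
      · change eval₂ _ _ (C x) * eval₂ _ _ X = _
        rw [eval₂_C, eval₂_X, RingHom.id_apply, Algebra.smul_def, Algebra.commutes]
    rw [← h1]
    change _ = eval₂ _ _ p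
    rw [eval₂_eq_sum_range' _ (n := p.natDegree + 2) (by omega)]
    refine Finset.sum_congr rfl fun i _ => ?_
    rw [← map_pow, RingHom.id_apply, Algebra.smul_def, Algebra.commutes]
  have h1 : p.coeff 1 ∈ U := by
    refine mem_of_forall_sum_pow_smul_mem U (p.natDegree + 2) p.coeff (fun c => ?_) (by omega)
    rw [heval]
    exact Submodule.subset_span ⟨_, W.add_mem hw (W.smul_mem c hx), rfl⟩
  have hk : (k + 1 : ℂ) ≠ 0 := by exact_mod_cast k.succ_ne_zero
  rw [← Submodule.smul_mem_iff _ hk]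
  have h2 := (hcoeff k).2
  rw [← hp] at h2
  have := sub_mem (Submodule.mem_sup_left h1 : _ ∈ U ⊔ (1 ⊔ W) ^ k)
    (Submodule.mem_sup_right h2 : _ ∈ U ⊔ (1 ⊔ W) ^ k)
  simpa using this

/-- Modulo shorter products the factors commute, and symmetric products are spanned by pure powers.
-/
theorem one_sup_pow_le (hW : ∀ x ∈ W, ∀ y ∈ W, x * y - y * x ∈ W) (k : ℕ) :
    (1 ⊔ W) ^ (k + 1) ≤ Submodule.span ℂ {y | ∃ u ∈ W, y = u ^ (k + 1)} ⊔ (1 ⊔ W) ^ k := by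
  induction k with
  | zero =>
    rw [zero_add, pow_one, pow_zero]
    refine sup_le le_sup_right (le_sup_of_le_left fun x hx => Submodule.subset_span ⟨x, hx, ?_⟩)
    rw [pow_one]
  | succ k ih =>
    rw [pow_succ', Submodule.sup_mul, one_mul]
    refine sup_le le_sup_right ?_
    refine (mul_le_mul' le_rfl ih).trans ?_
    rw [Submodule.mul_sup]
    refine sup_le ?_ (le_sup_of_le_right ?_)
    · rw [Submodule.mul_le]
      intro x hx y hy
      induction hy using Submodule.span_induction with
      | mem y hy =>
        obtain ⟨w, hw, rfl⟩ := hy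
        exact mul_pow_mem hW hw hx (k + 1)
      | zero => simp
      | add y z _ _ hy hz => rw [mul_add]; exact add_mem hy hz
      | smul c y _ hy => rw [mul_smul_comm]; exact Submodule.smul_mem _ c hy
    · rw [pow_succ']
      exact mul_le_mul' le_sup_right le_rfl

end Polarization

/-! ### Lattices -/

section Lattice

open Matrix Polynomial LaurentPolynomial

variable {n : ℕ}

instance isScalarTower_polynomial_laurentPolynomial : IsScalarTower ℂ ℂ[X] ℂ[T;T⁻¹] :=
  IsScalarTower.of_algebraMap_eq fun c => (toLaurent_C c).symm

theorem laurent_smul_def (p : ℂ[X]) (r : ℂ[T;T⁻¹]) : p • r = toLaurent p * r := by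
  rw [Algebra.smul_def, algebraMap_eq_toLaurent]

/-- `v ↦ z ^ (-m) v` as a map `ℂ[z]^ι → ℂ[z, z⁻¹]^ι`. -/
def shiftIncl (ι : Type*) (m : ℕ) : (ι → ℂ[X]) →ₗ[ℂ[X]] (ι → ℂ[T;T⁻¹]) where
  toFun v i := (T (-m) : ℂ[T;T⁻¹]) * toLaurent (v i)
  map_add' u v := by ext1 i; simp [mul_add]
  map_smul' c v := by
    ext1 i
    simp only [Pi.smul_apply, laurent_smul_def, smul_eq_mul, map_mul, RingHom.id_apply]
    ring

theorem shiftIncl_injective (ι : Type*) (m : ℕ) : Function.Injective (shiftIncl ι m) := by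
  intro u v h
  ext1 i
  have := congrFun h i
  exact toLaurent_injective ((isUnit_T (R := ℂ) (-m)).mul_left_cancel this)

/-- The matrices over `ℂ[z, z⁻¹]` with entries in `z ^ (-m) ℂ[z]`. -/
def boundedMatrices (n m : ℕ) : Submodule ℂ[X] (Matrix (Fin n) (Fin n) ℂ[T;T⁻¹]) where
  carrier := {y | ∃ q : Matrix (Fin n) (Fin n) ℂ[X], y = (T (-m) : ℂ[T;T⁻¹]) • q.map toLaurent}
  add_mem' := by
    rintro _ _ ⟨p, rfl⟩ ⟨q, rfl⟩
    exact ⟨p + q, by ext1; simp [mul_add]⟩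
  zero_mem' := ⟨0, by ext1; simp⟩
  smul_mem' := by
    rintro c _ ⟨p, rfl⟩
    refine ⟨c • p, ?_⟩
    ext1 i j
    simp only [Matrix.smul_apply, laurent_smul_def, smul_eq_mul, map_mul, map_apply]
    ring

theorem boundedMatrices_fg (n m : ℕ) : (boundedMatrices n m).FG := by
  have : boundedMatrices n m = Submodule.span ℂ[X]
      (Set.range fun p : Fin n × Fin n => (T (-m) : ℂ[T;T⁻¹]) • single p.1 p.2 1) := by
    refine le_antisymm ?_ ?_
    · rintro _ ⟨q, rfl⟩
      have : (T (-m) : ℂ[T;T⁻¹]) • q.map toLaurent =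
          ∑ i, ∑ j, q i j • ((T (-m) : ℂ[T;T⁻¹]) • single i j (1 : ℂ[T;T⁻¹])) := by
        ext1 k l
        simp only [Matrix.sum_apply, Matrix.smul_apply, map_apply, laurent_smul_def, smul_eq_mul]
        rw [Finset.sum_eq_single k, Finset.sum_eq_single l, single_apply_same, mul_one, mul_comm]
        all_goals simp +contextual [single_apply]
      rw [this]
      exact sum_mem fun i _ => sum_mem fun j _ =>
        Submodule.smul_mem _ _ (Submodule.subset_span ⟨(i, j), rfl⟩)
    · rw [Submodule.span_le]
      rintro _ ⟨⟨i, j⟩, rfl⟩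
      exact ⟨single i j 1, by simp [Matrix.map_single, smul_single]⟩
  rw [this]
  exact Submodule.fg_span (Set.finite_range _)

theorem boundedMatrices_mono {n a b : ℕ} (h : a ≤ b) :
    boundedMatrices n a ≤ boundedMatrices n b := by
  rintro _ ⟨q, rfl⟩
  refine ⟨(X ^ (b - a) : ℂ[X]) • q, ?_⟩
  ext1 i j
  simp only [Matrix.smul_apply, map_apply, smul_eq_mul, map_mul, toLaurent_X_pow, ← mul_assoc, ← T_add]
  congr 2
  omega

theorem one_mem_boundedMatrices (n m : ℕ) : 1 ∈ boundedMatrices n m :=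
  boundedMatrices_mono (Nat.zero_le m) ⟨1, by ext1; simp [one_apply]⟩

theorem mul_mem_boundedMatrices {a b : ℕ} {x y : Matrix (Fin n) (Fin n) ℂ[T;T⁻¹]}
    (hx : x ∈ boundedMatrices n a) (hy : y ∈ boundedMatrices n b) :
    x * y ∈ boundedMatrices n (a + b) := by
  obtain ⟨p, rfl⟩ := hx
  obtain ⟨q, rfl⟩ := hy
  refine ⟨p * q, ?_⟩
  rw [Matrix.map_mul, smul_mul_assoc, mul_smul_comm, smul_smul, ← T_add]
  congr 2
  push_cast
  ring

theorem pow_le_boundedMatrices {W : Submodule ℂ (Matrix (Fin n) (Fin n) ℂ[T;T⁻¹])} {m : ℕ}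
    (hW : W ≤ (boundedMatrices n m).restrictScalars ℂ) (k : ℕ) :
    (1 ⊔ W) ^ k ≤ (boundedMatrices n (k * m)).restrictScalars ℂ := by
  have hone : ∀ a, (1 : Submodule ℂ (Matrix (Fin n) (Fin n) ℂ[T;T⁻¹])) ≤
      (boundedMatrices n a).restrictScalars ℂ := by
    intro a
    rw [Submodule.one_le]
    exact one_mem_boundedMatrices n a
  induction k with
  | zero => rw [pow_zero]; exact hone _
  | succ k ih =>
    rw [pow_succ, Submodule.mul_le]
    intro x hx y hy
    rw [Nat.succ_mul]
    exact mul_mem_boundedMatrices (ih hx) (sup_le (hone m) hW hy)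

variable {W : Submodule ℂ (Matrix (Fin n) (Fin n) ℂ[T;T⁻¹])} {m N : ℕ}

/-- `W` contains `z ^ N E_ij` only up to a scalar matrix, which every commutator kills. From the
first iterate on one is inside `W`; the zeroth is bounded because it has no pole. -/
theorem iterate_ad_mem (hlie : ∀ x ∈ W, ∀ y ∈ W, x * y - y * x ∈ W)
    (hW : W ≤ (boundedMatrices n m).restrictScalars ℂ)
    (hN : ∀ i j, ∃ r : ℂ[T;T⁻¹], (T N : ℂ[T;T⁻¹]) • single i j 1 - r • 1 ∈ W)
    {x : Matrix (Fin n) (Fin n) ℂ[T;T⁻¹]} (hx : x ∈ W) (k : ℕ) (i j : Fin n) :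
    (fun y => x * y - y * x)^[k] ((T N : ℂ[T;T⁻¹]) • single i j 1) ∈ boundedMatrices n m := by
  rcases k with _ | k
  · refine boundedMatrices_mono (Nat.zero_le m) ⟨(X ^ N : ℂ[X]) • single i j 1, ?_⟩
    ext1 k l
    simp [single_apply]
  · refine hW ?_
    induction k with
    | zero =>
      obtain ⟨r, hr⟩ := hN i j
      have := hlie x hx _ hr
      simpa [mul_sub, sub_mul] using this
    | succ k ih =>
      rw [Function.iterate_succ_apply']
      exact hlie x hx _ ih

theorem exists_toLaurent_eq_coeff_charpoly (hn : n ≠ 0)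
    (hlie : ∀ x ∈ W, ∀ y ∈ W, x * y - y * x ∈ W) (htr : ∀ x ∈ W, x.trace = 0)
    (hW : W ≤ (boundedMatrices n m).restrictScalars ℂ)
    (hN : ∀ i j, ∃ r : ℂ[T;T⁻¹], (T N : ℂ[T;T⁻¹]) • single i j 1 - r • 1 ∈ W)
    {x : Matrix (Fin n) (Fin n) ℂ[T;T⁻¹]} (hx : x ∈ W) (k : ℕ) :
    ∃ q : ℂ[X], toLaurent q = x.charpoly.coeff k := by
  -- The eigenvalues live in this field; integrality of the coefficients descends to `ℂ[z, z⁻¹]`,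
  -- where `ℂ[z]` is integrally closed.
  let K := AlgebraicClosure (FractionRing ℂ[T;T⁻¹])
  let f : ℂ[T;T⁻¹] →+* K := algebraMap ℂ[T;T⁻¹] K
  have hf : Function.Injective f := by
    have := (FaithfulSMul.algebraMap_injective (FractionRing ℂ[T;T⁻¹]) K).comp
      (IsFractionRing.injective ℂ[T;T⁻¹] (FractionRing ℂ[T;T⁻¹]))
    rwa [← RingHom.coe_comp, ← IsScalarTower.algebraMap_eq] at this
  let Φ : Matrix (Fin n) (Fin n) ℂ[T;T⁻¹] →ₗ[ℂ[X]] Matrix (Fin n) (Fin n) K :=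
    (IsScalarTower.toAlgHom ℂ[X] ℂ[T;T⁻¹] K).toLinearMap.mapMatrix
  have hΦ : ∀ y, Φ y = y.map f := fun y => rfl
  have hit : ∀ (l : ℕ) (y : Matrix (Fin n) (Fin n) ℂ[T;T⁻¹]),
      (fun z => Φ x * z - z * Φ x)^[l] (Φ y) = Φ ((fun z => x * z - z * x)^[l] y) := by
    intro l
    induction l with
    | zero => intro y; rfl
    | succ l ih =>
      intro y
      rw [Function.iterate_succ_apply, Function.iterate_succ_apply, ← ih, map_sub]
      simp only [hΦ, Matrix.map_mul]
  have hcard : IsUnit ((Fintype.card (Fin n) : ℕ) : ℂ[X]) := by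
    rw [Fintype.card_fin, ← C_eq_natCast, Polynomial.isUnit_C, isUnit_iff_ne_zero]
    exact_mod_cast hn
  have hint : IsIntegral ℂ[X] ((Φ x).charpoly.coeff k) := by
    refine isIntegral_coeff_charpoly (F := (boundedMatrices n m).map Φ) (d := f (T N)) ?_ hcard
      ((boundedMatrices_fg n m).map Φ) ?_ ?_ k
    · rw [hΦ, ← AddMonoidHom.map_trace, htr x hx, map_zero]
    · rw [Ne, map_eq_zero_iff f hf]
      exact (isUnit_T (N : ℤ)).ne_zero
    · intro l i j
      have : f (T N) • single i j (1 : K) = Φ ((T N : ℂ[T;T⁻¹]) • single i j 1) := by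
        ext1 a b
        simp [hΦ, single_apply, apply_ite f]
      rw [this, hit]
      exact ⟨_, iterate_ad_mem hlie hW hN hx l i j, rfl⟩
  have heq : (Φ x).charpoly.coeff k = algebraMap ℂ[T;T⁻¹] K (x.charpoly.coeff k) := by
    rw [hΦ, ← coeff_map, ← charpoly_map]
  rw [heq] at hint
  have := (isIntegral_algHom_iff (IsScalarTower.toAlgHom ℂ[X] ℂ[T;T⁻¹] K) hf).mp hint
  exact IsIntegrallyClosedIn.algebraMap_eq_of_integral this

/-- It suffices that products of `n` factors lie in the span of those with at most `n - 1`.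
Polarization reduces this to `w ^ n`, and Cayley–Hamilton with coefficients in `ℂ[z]` expresses `w ^
n` through lower powers. -/
theorem mul_mem_span (hn : n ≠ 0)
    (hlie : ∀ x ∈ W, ∀ y ∈ W, x * y - y * x ∈ W) (htr : ∀ x ∈ W, x.trace = 0)
    (hW : W ≤ (boundedMatrices n m).restrictScalars ℂ)
    (hN : ∀ i j, ∃ r : ℂ[T;T⁻¹], (T N : ℂ[T;T⁻¹]) • single i j 1 - r • 1 ∈ W)
    {x y : Matrix (Fin n) (Fin n) ℂ[T;T⁻¹]} (hx : x ∈ W)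
    (hy : y ∈ Submodule.span ℂ[X] ((1 ⊔ W) ^ (n - 1) : Submodule ℂ _)) :
    x * y ∈ Submodule.span ℂ[X]
      (((1 ⊔ W) ^ (n - 1) : Submodule ℂ _) : Set (Matrix (Fin n) (Fin n) ℂ[T;T⁻¹])) := by
  set L := Submodule.span ℂ[X]
    (((1 ⊔ W) ^ (n - 1) : Submodule ℂ _) : Set (Matrix (Fin n) (Fin n) ℂ[T;T⁻¹])) with hL
  have hle : (1 ⊔ W) ^ (n - 1) ≤ L.restrictScalars ℂ := Submodule.subset_span
  have hpow : ∀ w ∈ W, w ^ n ∈ L := by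
    intro w hw
    have hch := aeval_self_charpoly w
    rw [aeval_eq_sum_range, charpoly_natDegree_eq_dim, Fintype.card_fin, Finset.sum_range_succ]
      at hch
    have hlead : w.charpoly.coeff n = 1 := by
      have := w.charpoly_monic.coeff_natDegree
      rwa [charpoly_natDegree_eq_dim, Fintype.card_fin] at this
    rw [hlead, one_smul] at hch
    rw [eq_neg_of_add_eq_zero_right hch]
    refine neg_mem (sum_mem fun i hi => ?_)
    obtain ⟨q, hq⟩ := exists_toLaurent_eq_coeff_charpoly hn hlie htr hW hN hw i
    rw [← hq, ← algebraMap_eq_toLaurent, algebraMap_smul]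
    refine L.smul_mem q (hle (one_sup_pow_mono ?_ (mem_one_sup_pow hw i)))
    have := Finset.mem_range.mp hi
    omega
  have hle' : (1 ⊔ W) ^ n ≤ L.restrictScalars ℂ := by
    have := one_sup_pow_le hlie (n - 1)
    rw [Nat.sub_add_cancel (Nat.one_le_iff_ne_zero.mpr hn)] at this
    refine this.trans (sup_le (Submodule.span_le.mpr ?_) hle)
    rintro _ ⟨u, hu, rfl⟩
    exact hpow u hu
  induction hy using Submodule.span_induction with
  | mem y hy =>
    refine hle' ?_
    have := Submodule.mul_mem_mul (Submodule.mem_sup_right hx : x ∈ 1 ⊔ W) hy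
    rwa [← pow_succ', Nat.sub_add_cancel (Nat.one_le_iff_ne_zero.mpr hn)] at this
  | zero => simp
  | add y z _ _ hy hz => rw [mul_add]; exact L.add_mem hy hz
  | smul c y _ hy => rw [mul_smul_comm]; exact L.smul_mem c hy

/-- A lattice in `ℂ[z, z⁻¹]^n` between `ℂ[z]^n` and `z ^ (-a) ℂ[z]^n` has a basis of `n` elements,
the columns of an invertible matrix. -/
theorem exists_basis_matrix {a : ℕ} (Λ : Submodule ℂ[X] (Fin n → ℂ[T;T⁻¹]))
    (h1 : ∀ j, Pi.single j 1 ∈ Λ) (h2 : Λ ≤ LinearMap.range (shiftIncl (Fin n) a)) :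
    ∃ P Q : Matrix (Fin n) (Fin n) ℂ[T;T⁻¹], Q * P = 1 ∧ P * Q = 1 ∧
      (∀ j, P.col j ∈ Λ) ∧ ∀ v ∈ Λ, ∃ c : Fin n → ℂ[X], v = P *ᵥ (toLaurent ∘ c) := by
  have hfin : Module.Finite ℂ[X] Λ :=
    Module.Finite.of_injective (Submodule.inclusion h2) (Submodule.inclusion_injective h2)
  have htf : Module.IsTorsionFree ℂ[X] ℂ[T;T⁻¹] := by
    refine Module.IsTorsionFree.of_smul_eq_zero fun p r h => ?_
    rwa [laurent_smul_def, mul_eq_zero, toLaurent_eq_zero] at h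
  have hfree : Module.Free ℂ[X] Λ := inferInstance
  have hrank : Module.finrank ℂ[X] Λ = n := by
    refine le_antisymm ?_ ?_
    -- `Λ` lies between two free modules of rank `n`: `h2` bounds the rank from above, the
    -- coordinate vectors in `h1` from below.
    · have := LinearMap.finrank_le_finrank_of_injective (Submodule.inclusion_injective h2)
      rwa [LinearMap.finrank_range_of_inj (shiftIncl_injective _ _), Module.finrank_pi,
        Fintype.card_fin] at this
    · have h0 : LinearMap.range (shiftIncl (Fin n) 0) ≤ Λ := by
        rintro _ ⟨v, rfl⟩
        have : shiftIncl (Fin n) 0 v = ∑ j, v j • Pi.single j (1 : ℂ[T;T⁻¹]) := by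
          ext1 i
          simp [shiftIncl, Pi.single_apply, laurent_smul_def]
        rw [this]
        exact sum_mem fun j _ => Λ.smul_mem _ (h1 j)
      have := LinearMap.finrank_le_finrank_of_injective (Submodule.inclusion_injective h0)
      rwa [LinearMap.finrank_range_of_inj (shiftIncl_injective _ _), Module.finrank_pi,
        Fintype.card_fin] at this
  let b := Module.finBasisOfFinrankEq ℂ[X] Λ hrank
  let P : Matrix (Fin n) (Fin n) ℂ[T;T⁻¹] := of fun i j => (b j : Fin n → ℂ[T;T⁻¹]) i
  have hrepr : ∀ v (hv : v ∈ Λ), v = P *ᵥ (toLaurent ∘ b.repr ⟨v, hv⟩) := by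
    intro v hv
    have := congrArg (Subtype.val) (b.sum_repr ⟨v, hv⟩)
    ext1 i
    refine (congrFun this i).symm.trans ?_
    rw [Submodule.coe_sum, Finset.sum_apply]
    exact Finset.sum_congr rfl fun k _ => (laurent_smul_def _ _).trans (mul_comm _ _)
  -- The columns of `Q` are the coordinates of the standard vectors in the basis of `Λ`, so `Q` is
  -- even polynomial.
  let Q : Matrix (Fin n) (Fin n) ℂ[T;T⁻¹] := of fun i j => toLaurent (b.repr ⟨_, h1 j⟩ i)
  have hPQ : P * Q = 1 := by
    ext1 i j
    have := congrFun (hrepr _ (h1 j)) i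
    rw [Pi.single_apply] at this
    rw [one_apply, this]
    rfl
  exact ⟨P, Q, mul_eq_one_comm.mp hPQ, hPQ, fun j => (b j).2, fun v hv => ⟨_, hrepr v hv⟩⟩

/-- A commutator-closed space of traceless matrices over `ℂ[z, z⁻¹]` which is commensurable with
the traceless matrices over `ℂ[z]` is conjugate to a space of matrices over `ℂ[z]`. -/
theorem exists_conj_polynomial (hn : n ≠ 0)
    (hlie : ∀ x ∈ W, ∀ y ∈ W, x * y - y * x ∈ W) (htr : ∀ x ∈ W, x.trace = 0)
    (hW : W ≤ (boundedMatrices n m).restrictScalars ℂ)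
    (hN : ∀ i j, ∃ r : ℂ[T;T⁻¹], (T N : ℂ[T;T⁻¹]) • single i j 1 - r • 1 ∈ W) :
    ∃ P Q : Matrix (Fin n) (Fin n) ℂ[T;T⁻¹], Q * P = 1 ∧ P * Q = 1 ∧
      ∀ w ∈ W, ∃ c : Matrix (Fin n) (Fin n) ℂ[X], Q * w * P = c.map toLaurent := by
  set L := Submodule.span ℂ[X]
    (((1 ⊔ W) ^ (n - 1) : Submodule ℂ _) : Set (Matrix (Fin n) (Fin n) ℂ[T;T⁻¹])) with hL
  have hLb : L ≤ boundedMatrices n ((n - 1) * m) :=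
    Submodule.span_le.mpr (pow_le_boundedMatrices hW (n - 1))
  have hL1 : 1 ∈ L := Submodule.subset_span (Submodule.one_le.mp
    (one_le_pow_of_one_le' le_sup_left (n - 1)))
  let Λ := Submodule.span ℂ[X] {v | ∃ y ∈ L, ∃ j, v = y.col j}
  have hstab : ∀ w ∈ W, ∀ v ∈ Λ, w *ᵥ v ∈ Λ := by
    intro w hw v hv
    induction hv using Submodule.span_induction with
    | mem v hv =>
      obtain ⟨y, hy, j, rfl⟩ := hv
      exact Submodule.subset_span ⟨w * y, mul_mem_span hn hlie htr hW hN hw hy, j, rfl⟩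
    | zero => simp
    | add u v _ _ hu hv => rw [mulVec_add]; exact Λ.add_mem hu hv
    | smul c v _ hv => rw [mulVec_smul]; exact Λ.smul_mem c hv
  obtain ⟨P, Q, hQP, hPQ, hcol, hspan⟩ := exists_basis_matrix (a := (n - 1) * m) Λ
    (fun j => Submodule.subset_span ⟨1, hL1, j, by
      ext1 i; simp [Pi.single_apply, one_apply]⟩) (by
    rw [Submodule.span_le]
    rintro _ ⟨y, hy, j, rfl⟩
    obtain ⟨q, rfl⟩ := hLb hy
    exact ⟨q.col j, by ext1 i; simp [shiftIncl]⟩)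
  refine ⟨P, Q, hQP, hPQ, fun w hw => ?_⟩
  choose c hc using fun j => hspan _ (hstab w hw _ (hcol j))
  refine ⟨of fun i j => c j i, ?_⟩
  have : w * P = P * (of fun i j => c j i).map toLaurent := by
    ext1 i j
    exact congrFun (hc j) i
  rw [mul_assoc, this, ← mul_assoc, hQP, one_mul]

end Lattice

/-! ### Yang-Baxter expressions as bilinear maps -/

section YangBaxter

variable {L : Type*} [LieRing L] [LieAlgebra ℂ L]

theorem tensor_induction₂ {P : L ⊗[ℂ] L → L ⊗[ℂ] L → Prop}
    (ht : ∀ a b c d : L, P (a ⊗ₜ[ℂ] b) (c ⊗ₜ[ℂ] d))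
    (hl : ∀ r r' s, P r s → P r' s → P (r + r') s)
    (hr : ∀ r s s', P r s → P r s' → P r (s + s')) (r s : L ⊗[ℂ] L) : P r s := by
  have hpure : ∀ (a b : L) s, P (a ⊗ₜ[ℂ] b) s := by
    intro a b s
    induction s using TensorProduct.induction_on with
    | zero => simpa using ht a b 0 0
    | tmul c d => exact ht a b c d
    | add s s' h h' => exact hr _ _ _ h h'
  induction r using TensorProduct.induction_on with
  | zero => simpa using hpure 0 0 s
  | tmul a b => exact hpure a b s
  | add r r' h h' => exact hl _ _ _ h h'

/-- `lie1213` as a bilinear map. -/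
def bilin1213 (L : Type*) [LieRing L] [LieAlgebra ℂ L] :
    L ⊗[ℂ] L →ₗ[ℂ] L ⊗[ℂ] L →ₗ[ℂ] (L ⊗[ℂ] L) ⊗[ℂ] L :=
  (TensorProduct.map₂ (bracket L) (TensorProduct.mk ℂ L L)).compr₂
    (TensorProduct.assoc ℂ L L L).symm.toLinearMap

/-- `lie1223` as a bilinear map. -/
def bilin1223 (L : Type*) [LieRing L] [LieAlgebra ℂ L] :
    L ⊗[ℂ] L →ₗ[ℂ] L ⊗[ℂ] L →ₗ[ℂ] (L ⊗[ℂ] L) ⊗[ℂ] L :=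
  (TensorProduct.mk ℂ (L ⊗[ℂ] L) (L ⊗[ℂ] L)).compr₂
    (((TensorProduct.lift (bracket L)).lTensor L).rTensor L ∘ₗ
      (TensorProduct.assoc ℂ L L L).toLinearMap.rTensor L ∘ₗ
        (TensorProduct.assoc ℂ (L ⊗[ℂ] L) L L).symm.toLinearMap)

/-- `lie1323` as a bilinear map. -/
def bilin1323 (L : Type*) [LieRing L] [LieAlgebra ℂ L] :
    L ⊗[ℂ] L →ₗ[ℂ] L ⊗[ℂ] L →ₗ[ℂ] (L ⊗[ℂ] L) ⊗[ℂ] L :=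
  TensorProduct.map₂ (TensorProduct.mk ℂ L L) (bracket L)

theorem lie1213_eq (r s : L ⊗[ℂ] L) : lie1213 r s = bilin1213 L r s := rfl

theorem lie1223_eq (r s : L ⊗[ℂ] L) : lie1223 r s = bilin1223 L r s := rfl

theorem lie1323_eq (r s : L ⊗[ℂ] L) : lie1323 r s = bilin1323 L r s := rfl

@[simp] theorem bilin1213_tmul (a b c d : L) :
    bilin1213 L (a ⊗ₜ[ℂ] b) (c ⊗ₜ[ℂ] d) = (⁅a, c⁆ ⊗ₜ[ℂ] b) ⊗ₜ[ℂ] d := rfl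

@[simp] theorem bilin1223_tmul (a b c d : L) :
    bilin1223 L (a ⊗ₜ[ℂ] b) (c ⊗ₜ[ℂ] d) = (a ⊗ₜ[ℂ] ⁅b, c⁆) ⊗ₜ[ℂ] d := rfl

@[simp] theorem bilin1323_tmul (a b c d : L) :
    bilin1323 L (a ⊗ₜ[ℂ] b) (c ⊗ₜ[ℂ] d) = (a ⊗ₜ[ℂ] c) ⊗ₜ[ℂ] ⁅b, d⁆ := rfl

/-- The flip on `L ⊗ L` as a linear map. -/
abbrev flip (L : Type*) [LieRing L] [LieAlgebra ℂ L] : L ⊗[ℂ] L →ₗ[ℂ] L ⊗[ℂ] L :=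
  (TensorProduct.comm ℂ L L).toLinearMap

theorem flip_tmul (a b : L) : flip L (a ⊗ₜ[ℂ] b) = b ⊗ₜ[ℂ] a := rfl

theorem flip_flip (t : L ⊗[ℂ] L) : flip L (flip L t) = t := by
  change TensorProduct.comm ℂ L L (TensorProduct.comm ℂ L L t) = t
  rw [TensorProduct.comm_comm]

/-- This identity and the next two describe how the three Yang–Baxter terms are permuted cyclically.
They unfold `Alt`, and they transport invariance relations of the Casimir element from one pair of
legs to another. -/
theorem cyc_bilin1213 (r s : L ⊗[ℂ] L) :
    cyc L (bilin1213 L r s) = bilin1323 L (flip L r) (flip L s) := by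
  refine tensor_induction₂ (P := fun r s =>
    cyc L (bilin1213 L r s) = bilin1323 L (flip L r) (flip L s)) ?_ ?_ ?_ r s
  · intro a b c d
    simp [cyc_tmul]
  · intro r r' s h h'
    simp only [map_add, LinearMap.add_apply, h, h']
  · intro r s s' h h'
    simp only [map_add, h, h']

theorem cyc_bilin1223 (r s : L ⊗[ℂ] L) :
    cyc L (bilin1223 L r s) = -bilin1213 L s (flip L r) := by
  refine tensor_induction₂ (P := fun r s =>
    cyc L (bilin1223 L r s) = -bilin1213 L s (flip L r)) ?_ ?_ ?_ r s
  · intro a b c d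
    simp only [bilin1223_tmul, cyc_tmul, flip_tmul, bilin1213_tmul]
    rw [← lie_skew, TensorProduct.neg_tmul, TensorProduct.neg_tmul]
  · intro r r' s h h'
    simp only [map_add, LinearMap.add_apply, h, h']
    abel
  · intro r s s' h h'
    simp only [map_add, LinearMap.add_apply, h, h']
    abel

theorem cyc_bilin1323 (r s : L ⊗[ℂ] L) :
    cyc L (bilin1323 L r s) = -bilin1223 L s (flip L r) := by
  refine tensor_induction₂ (P := fun r s =>
    cyc L (bilin1323 L r s) = -bilin1223 L s (flip L r)) ?_ ?_ ?_ r s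
  · intro a b c d
    simp only [bilin1323_tmul, cyc_tmul, flip_tmul, bilin1223_tmul]
    rw [← lie_skew, TensorProduct.tmul_neg, TensorProduct.neg_tmul]
  · intro r r' s h h'
    simp only [map_add, LinearMap.add_apply, h, h']
    abel
  · intro r s s' h h'
    simp only [map_add, LinearMap.add_apply, h, h']
    abel

/-- The contraction `a ⊗ b ↦ B(g, b) a`. -/
def contr (M : Type*) [AddCommGroup M] [Module ℂ M] (B : LinearMap.BilinForm ℂ L) (g : L) :
    M ⊗[ℂ] L →ₗ[ℂ] M :=
  (TensorProduct.rid ℂ M).toLinearMap ∘ₗ (B g).lTensor M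

@[simp] theorem contr_tmul {M : Type*} [AddCommGroup M] [Module ℂ M] (B : LinearMap.BilinForm ℂ L)
    (g : L) (a : M) (b : L) : contr M B g (a ⊗ₜ[ℂ] b) = B g b • a := by
  simp [contr]

theorem contr_add {M : Type*} [AddCommGroup M] [Module ℂ M] (B : LinearMap.BilinForm ℂ L)
    (g h : L) (t : M ⊗[ℂ] L) : contr M B (g + h) t = contr M B g t + contr M B h t := by
  simp [contr, LinearMap.lTensor_add]

theorem contr_smul {M : Type*} [AddCommGroup M] [Module ℂ M] (B : LinearMap.BilinForm ℂ L)
    (c : ℂ) (g : L) (t : M ⊗[ℂ] L) : contr M B (c • g) t = c • contr M B g t := by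
  simp [contr, LinearMap.lTensor_smul]

variable {B : LinearMap.BilinForm ℂ L}

/-- Contracting the last two legs translates a three-tensor identity into an identity between
operators `g ↦ contr B g r`. For the other two terms the bracket sits in a contracted leg, and
invariance of the form moves it onto the argument. -/
theorem contr_bilin1213 (r s : L ⊗[ℂ] L) (g h : L) :
    contr L B g (contr (L ⊗[ℂ] L) B h (bilin1213 L r s)) = ⁅contr L B g r, contr L B h s⁆ := by
  refine tensor_induction₂ (P := fun r s => contr L B g (contr (L ⊗[ℂ] L) B h (bilin1213 L r s)) =
    ⁅contr L B g r, contr L B h s⁆) ?_ ?_ ?_ r s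
  · intro a b c d
    simp [smul_smul]
  · intro r r' s h h'
    simp only [map_add, LinearMap.add_apply, h, h', add_lie]
  · intro r s s' h h'
    simp only [map_add, h, h', lie_add]

variable (hs : ∀ x y, B x y = B y x) (hB : ∀ x y z, B ⁅x, y⁆ z = B x ⁅y, z⁆)
include hs hB

theorem form_lie_cyclic (x y z : L) : B ⁅x, y⁆ z = B y ⁅z, x⁆ := by
  rw [hB, hs, hB]

theorem contr_bilin1223 (r s : L ⊗[ℂ] L) (g h : L) :
    contr L B g (contr (L ⊗[ℂ] L) B h (bilin1223 L r s)) = contr L B ⁅contr L B h s, g⁆ r := by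
  refine tensor_induction₂ (P := fun r s => contr L B g (contr (L ⊗[ℂ] L) B h (bilin1223 L r s)) =
    contr L B ⁅contr L B h s, g⁆ r) ?_ ?_ ?_ r s
  · intro a b c d
    simp [form_lie_cyclic hs hB, smul_smul]
  · intro r r' s h h'
    simp only [map_add, LinearMap.add_apply, h, h']
  · intro r s s' h h'
    simp only [map_add, h, h', add_lie, contr_add]

theorem contr_bilin1323 (r s : L ⊗[ℂ] L) (g h : L) :
    contr L B g (contr (L ⊗[ℂ] L) B h (bilin1323 L r s)) =
      contr L B ⁅contr L B g (flip L s), h⁆ r := by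
  refine tensor_induction₂ (P := fun r s => contr L B g (contr (L ⊗[ℂ] L) B h (bilin1323 L r s)) =
    contr L B ⁅contr L B g (flip L s), h⁆ r) ?_ ?_ ?_ r s
  · intro a b c d
    simp [form_lie_cyclic hs hB, smul_smul, mul_comm]
  · intro r r' s h h'
    simp only [map_add, LinearMap.add_apply, h, h']
  · intro r s s' h h'
    simp only [map_add, h, h', add_lie, contr_add]

theorem contr_coboundary (t : L ⊗[ℂ] L) (f g : L) :
    contr L B g (coboundary t f) = ⁅f, contr L B g t⁆ - contr L B ⁅f, g⁆ t := by
  change contr L B g ⁅f, t⁆ = _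
  induction t using TensorProduct.induction_on with
  | zero => simp
  | tmul a b =>
    have : B ⁅f, g⁆ b = -B g ⁅f, b⁆ := by
      rw [form_lie_cyclic hs hB, ← lie_skew, map_neg]
    simp [this]
  | add s t h h' =>
    simp only [lie_add, map_add, h, h']
    abel

end YangBaxter

/-! ### The standard `r`-matrix of `𝔰𝔩(n, ℂ)` -/

section Constant

variable {n : ℕ}

/-- The Killing form `2n tr(ab)` of `𝔰𝔩(n, ℂ)`. -/
def killing (n : ℕ) : LinearMap.BilinForm ℂ (G n) :=
  LinearMap.mk₂ ℂ (fun a b => (2 * n : ℂ) * (a.val * b.val).trace)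
    (fun a b c => by simp [add_mul, mul_add]) (fun c a b => by simp [mul_left_comm])
    (fun a b c => by simp [mul_add]) (fun c a b => by simp [mul_left_comm])

theorem killing_apply (a b : G n) : killing n a b = (2 * n : ℂ) * (a.val * b.val).trace := rfl

theorem killing_symm (a b : G n) : killing n a b = killing n b a := by
  rw [killing_apply, killing_apply, Matrix.trace_mul_comm]

theorem killing_lie (a b c : G n) : killing n ⁅a, b⁆ c = killing n a ⁅b, c⁆ := by
  rw [killing_apply, killing_apply, LieAlgebra.SpecialLinear.sl_bracket,
    LieAlgebra.SpecialLinear.sl_bracket]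
  congr 1
  rw [sub_mul, mul_sub, Matrix.trace_sub, Matrix.trace_sub, mul_assoc, mul_assoc b.val,
    Matrix.trace_mul_comm b.val, mul_assoc]

theorem trace_val (a : G n) : a.val.trace = 0 := a.2

theorem val_slProj {m : Matrix (Fin n) (Fin n) ℂ} (hm : m.trace = 0) : (slProj n m).val = m := by
  simp [slProj, hm]

theorem slProj_val (a : G n) : slProj n a.val = a := Subtype.ext (val_slProj (trace_val a))

theorem sum_smul_e (m : Matrix (Fin n) (Fin n) ℂ) : ∑ i, ∑ j, m i j • e i j = slProj n m := by
  conv_rhs => rw [Matrix.matrix_eq_sum_single m]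
  simp only [map_sum, e, ← map_smul, Matrix.smul_single, smul_eq_mul, mul_one]

theorem killing_e (a : G n) (i j : Fin n) : killing n a (e j i) = (2 * n : ℂ) * a.val i j := by
  rw [killing_apply]
  congr 1
  have : (e j i : G n).val = Matrix.single j i 1 -
    (Matrix.trace (Matrix.single j i (1 : ℂ)) / n) • (1 : Matrix (Fin n) (Fin n) ℂ) := rfl
  rw [this, mul_sub, Matrix.trace_sub, mul_smul_comm, mul_one, Matrix.trace_smul, trace_val,
    smul_zero, sub_zero, Matrix.trace_mul_single, MulOpposite.op_one, one_smul]

theorem killing_e' (a : G n) (i j : Fin n) : killing n (e j i) a = (2 * n : ℂ) * a.val i j := by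
  rw [killing_symm, killing_e]

/-- Half of the diagonal plus the strictly lower triangular part. -/
def lowerWeight (i j : Fin n) : ℂ := if j < i then 1 else if i = j then 1 / 2 else 0

/-- The linear map `½ π_𝔥 + π_-` of `𝔰𝔩(n, ℂ)`. -/
def lowerPart (n : ℕ) : G n →ₗ[ℂ] G n where
  toFun a := slProj n (Matrix.of fun i j => lowerWeight i j * a.val i j)
  map_add' a b := by
    rw [← map_add]
    congr 1
    ext1 i j
    simp [mul_add]
  map_smul' c a := by
    rw [← map_smul]
    congr 1
    ext1 i j
    simp [mul_left_comm]

theorem lowerPart_apply (a : G n) :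
    lowerPart n a = slProj n (Matrix.of fun i j => lowerWeight i j * a.val i j) := rfl

theorem val_lowerPart (a : G n) (i j : Fin n) :
    (lowerPart n a).val i j = lowerWeight i j * a.val i j := by
  rw [lowerPart_apply, val_slProj, Matrix.of_apply]
  have := trace_val a
  simp only [Matrix.trace, Matrix.diag_apply, Matrix.of_apply, lowerWeight, lt_irrefl, if_true,
    if_false] at this ⊢
  rw [← Finset.mul_sum, this, mul_zero]

/-- The constant part `½ C_𝔥 + C_-` of the standard `r`-matrix. -/
def rConst (n : ℕ) : G n ⊗[ℂ] G n := (1 / 2 : ℂ) • casimirH n + casimirMinus n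

theorem rConst_eq : rConst n =
    (2 * n : ℂ)⁻¹ • ∑ i : Fin n, ∑ j : Fin n, lowerWeight i j • e i j ⊗ₜ[ℂ] e j i := by
  rw [rConst, casimirH, casimirMinus, smul_comm, ← smul_add]
  congr 1
  rw [Finset.smul_sum, ← Finset.sum_add_distrib]
  refine Finset.sum_congr rfl fun i _ => ?_
  have : ∀ j, lowerWeight i j • e i j ⊗ₜ[ℂ] e j i =
      (if i = j then (1 / 2 : ℂ) • e i j ⊗ₜ[ℂ] e j i else 0) +
        if j < i then e i j ⊗ₜ[ℂ] e j i else 0 := by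
    intro j
    rcases lt_trichotomy i j with h | h | h
    · simp [lowerWeight, h.ne, h.not_gt]
    · simp [lowerWeight, h]
    · simp [lowerWeight, h, h.ne']
  simp only [this, Finset.sum_add_distrib, Finset.sum_ite_eq, Finset.mem_univ, if_true,
    Finset.sum_filter]

theorem flip_casimir : flip (G n) (casimir n) = casimir n := by
  simp only [casimir, map_smul, map_sum, flip_tmul]
  rw [Finset.sum_comm]

theorem rConst_add_flip : rConst n + flip (G n) (rConst n) = casimir n := by
  simp only [rConst_eq, map_smul, map_sum, flip_tmul, casimir]
  rw [← smul_add]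
  congr 1
  rw [Finset.sum_comm (f := fun i j => lowerWeight i j • e j i ⊗ₜ[ℂ] e i j),
    ← Finset.sum_add_distrib]
  refine Finset.sum_congr rfl fun i _ => ?_
  rw [← Finset.sum_add_distrib]
  refine Finset.sum_congr rfl fun j _ => ?_
  rw [← add_smul]
  convert! one_smul ℂ _
  rcases lt_trichotomy i j with h | h | h
  · simp [lowerWeight, h.ne, h.not_gt, h]
  · norm_num [lowerWeight, h]
  · simp [lowerWeight, h, h.ne, h.not_gt]

section

variable (hn : n ≠ 0)
include hn

theorem two_mul_natCast_ne_zero : (2 * n : ℂ) ≠ 0 := by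
  simpa using hn

theorem contr_casimir (a : G n) : contr (G n) (killing n) a (casimir n) = a := by
  have h := two_mul_natCast_ne_zero hn
  simp only [casimir, map_smul, map_sum, contr_tmul, killing_e, mul_smul, ← Finset.smul_sum]
  rw [sum_smul_e, slProj_val, ← mul_smul, ← mul_smul, mul_assoc, inv_mul_cancel₀ h, one_smul]

theorem contr_rConst (a : G n) : contr (G n) (killing n) a (rConst n) = lowerPart n a := by
  have h := two_mul_natCast_ne_zero hn
  simp only [rConst_eq, map_smul, map_sum, contr_tmul, killing_e]
  rw [lowerPart_apply, ← sum_smul_e, Finset.smul_sum]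
  refine Finset.sum_congr rfl fun i _ => ?_
  rw [Finset.smul_sum]
  refine Finset.sum_congr rfl fun j _ => ?_
  rw [smul_smul, smul_smul, Matrix.of_apply]
  congr 1
  field_simp

theorem contr_flip_rConst (a : G n) :
    contr (G n) (killing n) a (flip (G n) (rConst n)) = a - lowerPart n a := by
  rw [eq_sub_iff_add_eq', ← contr_rConst hn, ← map_add, rConst_add_flip, contr_casimir hn]

theorem tensor_eq_sum_contr {M : Type*} [AddCommGroup M] [Module ℂ M] (u : M ⊗[ℂ] G n) :
    u = ∑ i, ∑ j, ((2 * n : ℂ)⁻¹ • contr M (killing n) (e j i) u) ⊗ₜ[ℂ] e i j := by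
  have h := two_mul_natCast_ne_zero hn
  induction u using TensorProduct.induction_on with
  | zero => simp
  | add u v hu hv =>
    conv_lhs => rw [hu, hv]
    simp only [map_add, smul_add, TensorProduct.add_tmul, Finset.sum_add_distrib]
  | tmul m a =>
    conv_lhs => rw [← slProj_val a, ← sum_smul_e]
    simp only [TensorProduct.tmul_sum, contr_tmul, killing_e', smul_smul,
      TensorProduct.smul_tmul]
    refine Finset.sum_congr rfl fun i _ => Finset.sum_congr rfl fun j _ => ?_
    rw [← mul_assoc, inv_mul_cancel₀ h, one_mul]

theorem eq_zero_of_contr_eq_zero {M : Type*} [AddCommGroup M] [Module ℂ M] {u : M ⊗[ℂ] G n}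
    (hu : ∀ a, contr M (killing n) a u = 0) : u = 0 := by
  rw [tensor_eq_sum_contr hn u]
  simp [hu]

end

theorem killing_lowerPart (a b : G n) :
    killing n (lowerPart n a) b + killing n a (lowerPart n b) = killing n a b := by
  simp only [killing_apply, ← mul_add]
  congr 1
  simp only [Matrix.trace, Matrix.diag_apply, Matrix.mul_apply, val_lowerPart,
    ← Finset.sum_add_distrib]
  refine Finset.sum_congr rfl fun i _ => Finset.sum_congr rfl fun j _ => ?_
  rcases lt_trichotomy i j with h | h | h
  · simp [lowerWeight, h.ne, h.not_gt, h]
  · simp [lowerWeight, h]; ring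
  · simp [lowerWeight, h, h.ne, h.not_gt]

/-- This is the Rota–Baxter identity of weight `-1`, the operator form of the Yang–Baxter equation
for `rConst`. It is checked for each product of matrix entries, where it becomes a relation between
three weights. -/
theorem lowerPart_lie (a b : G n) : ⁅lowerPart n a, lowerPart n b⁆ =
    lowerPart n (⁅a, lowerPart n b⁆ + ⁅lowerPart n a, b⁆ - ⁅a, b⁆) := by
  ext i j
  rw [val_lowerPart]
  have hval : (⁅a, lowerPart n b⁆ + ⁅lowerPart n a, b⁆ - ⁅a, b⁆).val =
    ⁅a, lowerPart n b⁆.val + ⁅lowerPart n a, b⁆.val - ⁅a, b⁆.val := rfl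
  rw [hval]
  simp only [LieAlgebra.SpecialLinear.sl_bracket, Matrix.add_apply, Matrix.sub_apply, Matrix.mul_apply, val_lowerPart]
  rw [← sub_eq_zero]
  simp only [← Finset.sum_sub_distrib, ← Finset.sum_add_distrib, Finset.mul_sum]
  refine Finset.sum_eq_zero fun k _ => ?_
  -- The relation between the weights fails only for `i = k = j`, where the two entry products
  -- cancel in the commutator.
  by_cases h : i = k ∧ k = j
  · obtain ⟨rfl, rfl⟩ := h
    ring
  · have : lowerWeight i k * lowerWeight k j =
        lowerWeight i j * (lowerWeight k j + lowerWeight i k - 1) := by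
      simp only [lowerWeight]
      split_ifs <;> first | omega | norm_num
    linear_combination (a.val i k * b.val k j - b.val i k * a.val k j) * this

theorem cyb_rConst (hn : n ≠ 0) : bilin1213 (G n) (rConst n) (rConst n) +
    bilin1223 (G n) (rConst n) (rConst n) + bilin1323 (G n) (rConst n) (rConst n) = 0 := by
  refine eq_zero_of_contr_eq_zero hn fun h => eq_zero_of_contr_eq_zero hn fun g => ?_
  rw [map_add, map_add, map_add, map_add, contr_bilin1213,
    contr_bilin1223 killing_symm killing_lie, contr_bilin1323 killing_symm killing_lie,
    contr_rConst hn, contr_rConst hn, contr_rConst hn, contr_rConst hn, contr_flip_rConst hn,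
    lowerPart_lie, ← map_add, ← map_add, sub_lie, ← lie_skew (lowerPart n h) g]
  convert! map_zero (lowerPart n)
  abel

end Constant

/-! ### The classical Yang-Baxter equation for `r₀` and its twists -/

section CYBE

variable {n : ℕ}

/-- Bracketing a leg of `r` with both legs of `C` gives zero, by invariance of `C`. -/
theorem bilin1213_casimir_left (r : G n ⊗[ℂ] G n) :
    bilin1213 (G n) (casimir n) r + bilin1223 (G n) (casimir n) r = 0 := by
  induction r using TensorProduct.induction_on with
  | zero => simp
  | add r s hr hs => rw [map_add, map_add, add_add_add_comm, hr, hs, add_zero]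
  | tmul c d =>
    have key : ∀ t : G n ⊗[ℂ] G n,
        bilin1213 (G n) t (c ⊗ₜ[ℂ] d) + bilin1223 (G n) t (c ⊗ₜ[ℂ] d) =
          -(((LieAlgebra.ad ℂ (G n) c).rTensor (G n) t +
            (LieAlgebra.ad ℂ (G n) c).lTensor (G n) t) ⊗ₜ[ℂ] d) := by
      intro t
      induction t using TensorProduct.induction_on with
      | zero => simp
      | add s t hs ht =>
        simp only [map_add, LinearMap.add_apply]
        rw [add_add_add_comm, hs, ht, ← neg_add, ← TensorProduct.add_tmul, add_add_add_comm]
      | tmul a b =>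
        simp only [bilin1213_tmul, bilin1223_tmul, LinearMap.rTensor_tmul, LinearMap.lTensor_tmul,
          LieAlgebra.ad_apply]
        rw [← lie_skew c a, ← lie_skew c b, TensorProduct.add_tmul, TensorProduct.neg_tmul,
          TensorProduct.tmul_neg, TensorProduct.neg_tmul, TensorProduct.neg_tmul]
        abel
    rw [key, casimir_invariant, TensorProduct.zero_tmul, neg_zero]

theorem cyc_injective : Function.Injective (cyc (G n)) :=
  ((TensorProduct.assoc ℂ (G n) (G n) (G n)).trans
    (TensorProduct.comm ℂ (G n) (G n ⊗[ℂ] G n))).injective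

theorem bilin1323_casimir_right (r : G n ⊗[ℂ] G n) :
    bilin1223 (G n) r (casimir n) + bilin1323 (G n) r (casimir n) = 0 := by
  apply cyc_injective
  rw [map_add, cyc_bilin1223, cyc_bilin1323, map_zero, ← neg_add,
    bilin1213_casimir_left, neg_zero]

theorem bilin1213_casimir_right (r : G n ⊗[ℂ] G n) :
    bilin1213 (G n) r (casimir n) = bilin1323 (G n) (casimir n) (flip (G n) r) := by
  apply cyc_injective
  rw [cyc_bilin1213, cyc_bilin1323, flip_casimir]
  exact eq_neg_of_add_eq_zero_right (bilin1323_casimir_right _)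

theorem r₀_eq (x y : ℂˣ) :
    r₀ n x y = rConst n + (1 / ((x : ℂ) / y - 1)) • casimir n := rfl

theorem div_sub_one_ne_zero {x y : ℂˣ} (h : x ≠ y) : (x : ℂ) / y - 1 ≠ 0 := by
  rw [sub_ne_zero, Ne, div_eq_one_iff_eq y.ne_zero]
  exact fun h' => h (Units.ext h')

theorem r₀_add_flip {x y : ℂˣ} (h : x ≠ y) : r₀ n x y + flip (G n) (r₀ n y x) = 0 := by
  have h1 : (x : ℂ) - y ≠ 0 := sub_ne_zero.mpr fun h' => h (Units.ext h')
  have h2 : (y : ℂ) - x ≠ 0 := sub_ne_zero.mpr fun h' => h (Units.ext h'.symm)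
  have hx := x.ne_zero
  have hy := y.ne_zero
  rw [r₀_eq, r₀_eq, map_add, map_smul, flip_casimir, add_add_add_comm, rConst_add_flip, ← add_smul]
  have : (1 / ((x : ℂ) / y - 1)) + 1 / ((y : ℂ) / x - 1) = -1 := by
    rw [div_sub_one hy, div_sub_one hx]
    field_simp
    ring
  rw [this, neg_one_smul, add_neg_cancel]

/-- Beyond the constant equation `cyb_rConst`, invariance of `C` reduces all remaining terms to
multiples of `[C¹³, C²³]`, and the total coefficient vanishes by a rational identity. -/
theorem r₀_cybe (hn : n ≠ 0) {x y z : ℂˣ} (hxy : x ≠ y) (hxz : x ≠ z) (hyz : y ≠ z) :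
    bilin1213 (G n) (r₀ n x y) (r₀ n x z) + bilin1223 (G n) (r₀ n x y) (r₀ n y z) +
      bilin1323 (G n) (r₀ n x z) (r₀ n y z) = 0 := by
  have h1 := div_sub_one_ne_zero hxy
  have h2 := div_sub_one_ne_zero hxz
  have h3 := div_sub_one_ne_zero hyz
  have hy := y.ne_zero
  have hz := z.ne_zero
  rw [r₀_eq, r₀_eq, r₀_eq]
  set a : ℂ := 1 / ((x : ℂ) / y - 1) with ha
  set b : ℂ := 1 / ((x : ℂ) / z - 1) with hb
  set c : ℂ := 1 / ((y : ℂ) / z - 1) with hc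
  -- Put `u = x / y` and `v = y / z`, so that `x / z = u v`. The lone `b` comes from the mixed
  -- terms, through `rConst + flip rConst = C`.
  have habc : a * b - a * c + b * c + b = 0 := by
    have hx : (x : ℂ) / z = (x : ℂ) / y * (y / z) := by field_simp
    rw [hx] at h2 hb
    rw [ha, hb, hc]
    generalize (x : ℂ) / y = u at *
    generalize (y : ℂ) / z = v at *
    field_simp
    ring
  have e1 := cyb_rConst hn
  have e2 := eq_neg_of_add_eq_zero_left (bilin1213_casimir_left (rConst n))
  have e3 := eq_neg_of_add_eq_zero_left (bilin1323_casimir_right (rConst n))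
  have e4 := bilin1213_casimir_right (rConst n)
  have e5 : bilin1323 (G n) (casimir n) (flip (G n) (rConst n)) =
      bilin1323 (G n) (casimir n) (casimir n) - bilin1323 (G n) (casimir n) (rConst n) := by
    rw [← map_sub, ← rConst_add_flip, add_sub_cancel_left]
  have e6 := eq_neg_of_add_eq_zero_left (bilin1213_casimir_left (casimir n))
  have e7 := eq_neg_of_add_eq_zero_left (bilin1323_casimir_right (casimir n))
  rw [e7, neg_neg] at e6
  rw [add_assoc] at e1
  simp only [map_add, map_smul, LinearMap.add_apply, LinearMap.smul_apply, e2, e3, e4, e5, e6, e7,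
    eq_neg_of_add_eq_zero_left e1]
  have := congrArg (fun k : ℂ => k • bilin1323 (G n) (casimir n) (casimir n)) habc
  simp only [zero_smul] at this
  rw [← this]
  module

/-! ### Values of the twist equation at points -/

theorem ev₂_flip (x y : ℂˣ) (t : Loop n ⊗[ℂ] Loop n) :
    ev₂ x y (flip (Loop n) t) = flip (G n) (ev₂ y x t) := by
  induction t using TensorProduct.induction_on with
  | zero => simp
  | add s t hs ht => simp only [map_add, hs, ht]
  | tmul f g => rfl

/-- The evaluation of three-tensors. -/
def ev₃ (x y z : ℂˣ) :
    (Loop n ⊗[ℂ] Loop n) ⊗[ℂ] Loop n →ₗ[ℂ] (G n ⊗[ℂ] G n) ⊗[ℂ] G n :=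
  TensorProduct.map (ev₂ x y) (ev z)

theorem ev₃_tmul (x y z : ℂˣ) (f g h : Loop n) :
    ev₃ x y z ((f ⊗ₜ[ℂ] g) ⊗ₜ[ℂ] h) = (ev x f ⊗ₜ[ℂ] ev y g) ⊗ₜ[ℂ] ev z h := rfl

theorem ev₃_cyc (x y z : ℂˣ) (u : (Loop n ⊗[ℂ] Loop n) ⊗[ℂ] Loop n) :
    ev₃ x y z (cyc (Loop n) u) = cyc (G n) (ev₃ z x y u) := by
  induction u using TensorProduct.induction_on with
  | zero => simp
  | add s t hs ht => simp only [map_add, hs, ht]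
  | tmul t h =>
    induction t using TensorProduct.induction_on with
    | zero => simp
    | add s t hs ht => simp only [map_add, TensorProduct.add_tmul, hs, ht]
    | tmul f g => rfl

theorem ev₃_CYB (x y z : ℂˣ) (t : Loop n ⊗[ℂ] Loop n) : ev₃ x y z (CYB t) =
    bilin1213 (G n) (ev₂ x y t) (ev₂ x z t) + bilin1223 (G n) (ev₂ x y t) (ev₂ y z t) +
      bilin1323 (G n) (ev₂ x z t) (ev₂ y z t) := by
  have h : ∀ r s : Loop n ⊗[ℂ] Loop n, ev₃ x y z (lie1213 r s + lie1223 r s + lie1323 r s) =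
      bilin1213 (G n) (ev₂ x y r) (ev₂ x z s) + bilin1223 (G n) (ev₂ x y r) (ev₂ y z s) +
        bilin1323 (G n) (ev₂ x z r) (ev₂ y z s) := by
    simp only [lie1213_eq, lie1223_eq, lie1323_eq]
    intro r s
    refine tensor_induction₂ (P := fun r s => ev₃ x y z (bilin1213 (Loop n) r s +
      bilin1223 (Loop n) r s + bilin1323 (Loop n) r s) =
        bilin1213 (G n) (ev₂ x y r) (ev₂ x z s) + bilin1223 (G n) (ev₂ x y r) (ev₂ y z s) +
          bilin1323 (G n) (ev₂ x z r) (ev₂ y z s)) ?_ ?_ ?_ r s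
    · intro a b c d
      simp [ev₃_tmul, ev₂, ev_lie]
    · intro r r' s h h'
      simp only [map_add, LinearMap.add_apply] at h h' ⊢
      linear_combination (norm := abel) h + h'
    · intro r s s' h h'
      simp only [map_add] at h h' ⊢
      linear_combination (norm := abel) h + h'
  exact h t t

theorem ev₃_rTensor_δ₀ {x y : ℂˣ} (hxy : x ≠ y) (z : ℂˣ) (t : Loop n ⊗[ℂ] Loop n) :
    ev₃ x y z ((δ₀ n).rTensor (Loop n) t) =
      -(bilin1213 (G n) (r₀ n x y) (ev₂ x z t) + bilin1223 (G n) (r₀ n x y) (ev₂ y z t)) := by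
  induction t using TensorProduct.induction_on with
  | zero => simp
  | add s t hs ht =>
    simp only [map_add, hs, ht]
    abel
  | tmul f g =>
    rw [LinearMap.rTensor_tmul, ev₃, TensorProduct.map_tmul, ev₂_δ₀ f x y hxy]
    simp only [ev₂, TensorProduct.map_tmul]
    generalize r₀ n x y = r
    induction r using TensorProduct.induction_on with
    | zero => simp
    | add r s hr hs =>
      simp only [map_add, TensorProduct.add_tmul, LinearMap.add_apply] at hr hs ⊢
      linear_combination (norm := abel) hr + hs
    | tmul a b =>
      simp only [LinearMap.rTensor_tmul, LinearMap.lTensor_tmul, LieAlgebra.ad_apply,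
        bilin1213_tmul, bilin1223_tmul, TensorProduct.add_tmul]
      rw [← lie_skew a, ← lie_skew b]
      simp only [TensorProduct.neg_tmul, TensorProduct.tmul_neg]
      abel

theorem rMatrix_isSkew {t : Loop n ⊗[ℂ] Loop n} (ht : t + flip (Loop n) t = 0) :
    IsSkew (rMatrix t) := by
  intro x y hxy
  change _ + flip (G n) (rMatrix t y x) = 0
  rw [rMatrix, rMatrix, map_add, add_add_add_comm, r₀_add_flip hxy, ← ev₂_flip, ← map_add, ht,
    map_zero, add_zero]

/-- At three distinct points the twist equation says that the terms quadratic in `t` cancel the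
terms of the Yang–Baxter expression mixing `r₀` and `t`. What remains is the equation for `r₀`. -/
theorem rMatrix_solvesCYBE (hn : n ≠ 0) {t : Loop n ⊗[ℂ] Loop n}
    (ht : IsClassicalTwist (δ₀ n) t) : SolvesCYBE (rMatrix t) := by
  intro x y z hxy hxz hyz
  obtain ⟨hskew, hcyb⟩ := ht
  have hfl : ∀ x y : ℂˣ, flip (G n) (ev₂ x y t) = -ev₂ y x t := by
    intro x y
    rw [← ev₂_flip, ← map_neg]
    congr 1
    exact eq_neg_of_add_eq_zero_right hskew
  have hfr : ∀ {x y : ℂˣ}, x ≠ y → flip (G n) (r₀ n x y) = -r₀ n y x := fun h =>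
    eq_neg_of_add_eq_zero_right (r₀_add_flip h.symm)
  have h := congrArg (ev₃ x y z) hcyb
  rw [ev₃_CYB, Alt, map_add, map_add, ev₃_cyc, ev₃_cyc, ev₃_cyc, ev₃_rTensor_δ₀ hxy,
    ev₃_rTensor_δ₀ hxz.symm, ev₃_rTensor_δ₀ hyz] at h
  simp only [map_neg, map_add, cyc_bilin1213, cyc_bilin1223, cyc_bilin1323, hfl, hfr hxz.symm,
    flip_flip, LinearMap.neg_apply, neg_neg] at h
  have h0 := r₀_cybe hn hxy hxz hyz
  rw [lie1213_eq, lie1223_eq, lie1323_eq, rMatrix, rMatrix, rMatrix]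
  simp only [map_add, LinearMap.add_apply]
  linear_combination (norm := abel) h + h0

/-! ### Invariance under pointwise automorphisms -/

theorem map_isSkew {r : ℂˣ → ℂˣ → G n ⊗[ℂ] G n} (hr : IsSkew r) (φ : ℂˣ → (G n →ₗ[ℂ] G n)) :
    IsSkew fun x y => TensorProduct.map (φ x) (φ y) (r x y) := by
  intro x y hxy
  have := congrArg (TensorProduct.map (φ x) (φ y)) (hr x y hxy)
  rw [map_add, map_zero, TensorProduct.map_comm] at this
  exact this

theorem map_solvesCYBE {r : ℂˣ → ℂˣ → G n ⊗[ℂ] G n} (hr : SolvesCYBE r)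
    (φ : ℂˣ → (G n →ₗ⁅ℂ⁆ G n)) :
    SolvesCYBE fun x y => TensorProduct.map (φ x : G n →ₗ[ℂ] G n) (φ y : G n →ₗ[ℂ] G n) (r x y) := by
  intro x y z hxy hxz hyz
  have h := congrArg (TensorProduct.map (TensorProduct.map (φ x : G n →ₗ[ℂ] G n)
    (φ y : G n →ₗ[ℂ] G n)) (φ z : G n →ₗ[ℂ] G n)) (hr x y z hxy hxz hyz)
  rw [map_zero, map_add, map_add, lie1213_eq, lie1223_eq, lie1323_eq] at h
  rw [lie1213_eq, lie1223_eq, lie1323_eq, ← h]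
  beta_reduce
  generalize r x y = r1
  generalize r x z = r2
  generalize r y z = r3
  congr 1
  · congr 1
    · refine tensor_induction₂ (P := fun r s => bilin1213 (G n)
        (TensorProduct.map (φ x : G n →ₗ[ℂ] G n) (φ y : G n →ₗ[ℂ] G n) r)
        (TensorProduct.map (φ x : G n →ₗ[ℂ] G n) (φ z : G n →ₗ[ℂ] G n) s) =
        TensorProduct.map (TensorProduct.map (φ x : G n →ₗ[ℂ] G n)
          (φ y : G n →ₗ[ℂ] G n)) (φ z : G n →ₗ[ℂ] G n) (bilin1213 (G n) r s)) ?_ ?_ ?_ r1 r2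
      · intro a b c d
        simp
      · intro r r' s h h'
        simp only [map_add, LinearMap.add_apply, h, h']
      · intro r s s' h h'
        simp only [map_add, h, h']
    · refine tensor_induction₂ (P := fun r s => bilin1223 (G n)
        (TensorProduct.map (φ x : G n →ₗ[ℂ] G n) (φ y : G n →ₗ[ℂ] G n) r)
        (TensorProduct.map (φ y : G n →ₗ[ℂ] G n) (φ z : G n →ₗ[ℂ] G n) s) =
        TensorProduct.map (TensorProduct.map (φ x : G n →ₗ[ℂ] G n)
          (φ y : G n →ₗ[ℂ] G n)) (φ z : G n →ₗ[ℂ] G n) (bilin1223 (G n) r s)) ?_ ?_ ?_ r1 r3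
      · intro a b c d
        simp
      · intro r r' s h h'
        simp only [map_add, LinearMap.add_apply, h, h']
      · intro r s s' h h'
        simp only [map_add, h, h']
  · refine tensor_induction₂ (P := fun r s => bilin1323 (G n)
      (TensorProduct.map (φ x : G n →ₗ[ℂ] G n) (φ z : G n →ₗ[ℂ] G n) r)
      (TensorProduct.map (φ y : G n →ₗ[ℂ] G n) (φ z : G n →ₗ[ℂ] G n) s) =
      TensorProduct.map (TensorProduct.map (φ x : G n →ₗ[ℂ] G n)
        (φ y : G n →ₗ[ℂ] G n)) (φ z : G n →ₗ[ℂ] G n) (bilin1323 (G n) r s)) ?_ ?_ ?_ r2 r3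
    · intro a b c d
      simp
    · intro r r' s h h'
      simp only [map_add, LinearMap.add_apply, h, h']
    · intro r s s' h h'
      simp only [map_add, h, h']

end CYBE

/-! ### The loop algebra -/

section LoopAlgebra

open LaurentPolynomial

variable {n : ℕ}

/-- `a ↦ z ^ k a`. -/
def mono (k : ℤ) : G n →ₗ[ℂ] Loop n :=
  (toLoop n).toLinearMap ∘ₗ TensorProduct.mk ℂ ℂ[T;T⁻¹] (G n) (T k)

theorem mono_apply (k : ℤ) (a : G n) : mono k a = toLoop n (T k ⊗ₜ[ℂ] a) := rfl

theorem const_eq : const n = mono 0 := by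
  ext1 a
  rw [mono_apply, T_zero]
  rfl

theorem mono_lie (k l : ℤ) (a b : G n) : ⁅mono k a, mono l b⁆ = mono (k + l) ⁅a, b⁆ := by
  rw [mono_apply, mono_apply, toLoop_lie, ← T_add, mono_apply]

theorem ev_mono (x : ℂˣ) (k : ℤ) (a : G n) : ev x (mono k a) = (x : ℂ) ^ k • a := by
  rw [mono_apply, ev_toLoop_tmul, smeval_T_pow, Units.val_zpow_eq_zpow_val]

theorem mono_induction {P : Loop n → Prop} (hm : ∀ k a, P (mono k a))
    (hadd : ∀ f g, P f → P g → P (f + g)) (f : Loop n) : P f := by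
  refine loop_induction f ?_ ?_ hadd
  · simpa using hm 0 0
  · intro p a
    induction p using LaurentPolynomial.induction_on' with
    | add p q hp hq => rw [TensorProduct.add_tmul, map_add]; exact hadd _ _ hp hq
    | C_mul_T k c =>
      rw [← smul_eq_C_mul, TensorProduct.smul_tmul]
      exact hm k (c • a)

/-- The linear map with given values on the `z ^ k a`. -/
def loopLift {M : Type*} [AddCommGroup M] [Module ℂ M] (F : ℤ → G n →ₗ[ℂ] M) : Loop n →ₗ[ℂ] M :=
  TensorProduct.lift ((AddMonoidAlgebra.basis ℤ ℂ).constr ℂ F) ∘ₗ (toLoop n).symm.toLinearMap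

theorem loopLift_mono {M : Type*} [AddCommGroup M] [Module ℂ M] (F : ℤ → G n →ₗ[ℂ] M) (k : ℤ)
    (a : G n) : loopLift F (mono k a) = F k a := by
  have : (T k : ℂ[T;T⁻¹]) = AddMonoidAlgebra.basis ℤ ℂ k := by
    rw [AddMonoidAlgebra.basis_apply]; rfl
  rw [mono_apply, loopLift, LinearMap.comp_apply, LinearEquiv.coe_coe,
    LinearEquiv.symm_apply_apply, TensorProduct.lift.tmul, this, Module.Basis.constr_basis]

/-- The invariant form `(f, g) ↦ res₀ κ(f, g) dz / z`. -/
def loopForm (n : ℕ) : LinearMap.BilinForm ℂ (Loop n) :=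
  loopLift fun k => LinearMap.flip (loopLift fun l =>
    LinearMap.flip (if k + l = 0 then killing n else 0))

theorem loopForm_mono (k l : ℤ) (a b : G n) :
    loopForm n (mono k a) (mono l b) = if k + l = 0 then killing n a b else 0 := by
  rw [loopForm, loopLift_mono, LinearMap.flip_apply, loopLift_mono, LinearMap.flip_apply]
  split_ifs <;> rfl

theorem loopForm_symm (f g : Loop n) : loopForm n f g = loopForm n g f := by
  induction f using mono_induction with
  | hadd f f' h h' => rw [map_add, LinearMap.add_apply, h, h', map_add]
  | hm k a =>
    induction g using mono_induction with
    | hadd g g' h h' => rw [map_add, h, h', map_add, LinearMap.add_apply]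
    | hm l b => rw [loopForm_mono, loopForm_mono, add_comm, killing_symm]

theorem loopForm_lie (f g h : Loop n) : loopForm n ⁅f, g⁆ h = loopForm n f ⁅g, h⁆ := by
  induction f using mono_induction with
  | hadd f f' h h' => simp only [add_lie, map_add, LinearMap.add_apply, h, h']
  | hm k a =>
    induction g using mono_induction with
    | hadd g g' h h' => simp only [lie_add, add_lie, map_add, LinearMap.add_apply, h, h']
    | hm l b =>
      induction h using mono_induction with
      | hadd g g' h h' => simp only [lie_add, map_add, h, h']
      | hm m c => rw [mono_lie, mono_lie, loopForm_mono, loopForm_mono, add_assoc, killing_lie]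

/-- A loop as a matrix over `ℂ[z, z⁻¹]`. -/
def mat (n : ℕ) : Loop n →ₗ[ℂ] Matrix (Fin n) (Fin n) ℂ[T;T⁻¹] :=
  loopLift fun k =>
    { toFun := fun a => (T k : ℂ[T;T⁻¹]) • a.val.map C
      map_add' := fun a b => by
        ext1 i j
        simp [mul_add]
      map_smul' := fun c a => by
        ext1 i j
        simp [smul_eq_C_mul, mul_assoc] }

theorem mat_mono (k : ℤ) (a : G n) : mat n (mono k a) = (T k : ℂ[T;T⁻¹]) • a.val.map C := by
  rw [mat, loopLift_mono]
  rfl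

theorem mat_lie (f g : Loop n) : mat n ⁅f, g⁆ = mat n f * mat n g - mat n g * mat n f := by
  induction f using mono_induction with
  | hadd f f' h h' => simp only [add_lie, map_add, h, h', add_mul, mul_add]; abel
  | hm k a =>
    induction g using mono_induction with
    | hadd g g' h h' => simp only [lie_add, map_add, h, h', add_mul, mul_add]; abel
    | hm l b =>
      simp only [mono_lie, mat_mono, LieAlgebra.SpecialLinear.sl_bracket, smul_mul_assoc,
        mul_smul_comm, smul_smul, ← T_add, add_comm l k, ← smul_sub]
      congr 1
      rw [← Matrix.map_mul, ← Matrix.map_mul]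
      exact Matrix.map_sub C (map_sub C) _ _

theorem trace_mat (f : Loop n) : (mat n f).trace = 0 := by
  induction f using mono_induction with
  | hadd f f' h h' => rw [map_add, Matrix.trace_add, h, h', add_zero]
  | hm k a =>
    rw [mat_mono, Matrix.trace_smul, ← AddMonoidHom.map_trace, trace_val, map_zero, smul_zero]

/-- The loop with given matrix, corrected to have trace zero. -/
def ofMat (n : ℕ) : Matrix (Fin n) (Fin n) ℂ[T;T⁻¹] →ₗ[ℂ] Loop n where
  toFun m := ∑ i, ∑ j, toLoop n (m i j ⊗ₜ[ℂ] e i j)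
  map_add' m m' := by
    simp [TensorProduct.add_tmul, Finset.sum_add_distrib]
  map_smul' c m := by
    simp only [Matrix.smul_apply, ← TensorProduct.smul_tmul', map_smul, Finset.smul_sum,
      RingHom.id_apply]

theorem ofMat_apply (m : Matrix (Fin n) (Fin n) ℂ[T;T⁻¹]) :
    ofMat n m = ∑ i, ∑ j, toLoop n (m i j ⊗ₜ[ℂ] e i j) := rfl

theorem ofMat_mat (f : Loop n) : ofMat n (mat n f) = f := by
  induction f using mono_induction with
  | hadd f f' h h' => rw [map_add, map_add, h, h']
  | hm k a =>
    rw [mat_mono, ofMat_apply]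
    have : ∀ i j, toLoop n (((T k : ℂ[T;T⁻¹]) • a.val.map C) i j ⊗ₜ[ℂ] e i j) =
        mono k (a.val i j • e i j) := by
      intro i j
      rw [map_smul, mono_apply, ← map_smul, TensorProduct.smul_tmul', smul_eq_C_mul, mul_comm]
      rfl
    simp only [this, ← map_sum]
    rw [sum_smul_e, slProj_val]

theorem mat_injective : Function.Injective (mat n) :=
  Function.LeftInverse.injective ofMat_mat

/-- Evaluation of Laurent polynomials as a ring homomorphism. -/
def laurentEval (x : ℂˣ) : ℂ[T;T⁻¹] →+* ℂ where
  toFun p := p.smeval x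
  map_one' := by simp
  map_mul' := smeval_mul x
  map_zero' := by simp
  map_add' p q := by simp

theorem laurentEval_C_mul_T (x : ℂˣ) (c : ℂ) (k : ℤ) :
    laurentEval x (C c * T k) = c * (x : ℂ) ^ k := by
  change (C c * T k).smeval x = _
  rw [smeval_C_mul_T_n, smul_eq_mul, Units.val_zpow_eq_zpow_val]

theorem val_ev (x : ℂˣ) (f : Loop n) : (ev x f).val = (mat n f).map (laurentEval x) := by
  induction f using mono_induction with
  | hadd f f' h h' =>
    rw [map_add, map_add, Matrix.map_add _ (map_add _), ← h, ← h']
    rfl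
  | hm k a =>
    rw [ev_mono, mat_mono]
    ext1 i j
    rw [Matrix.map_apply, Matrix.smul_apply, Matrix.map_apply, smul_eq_mul, mul_comm,
      laurentEval_C_mul_T, mul_comm]
    rfl

theorem ev_ofMat (x : ℂˣ) (m : Matrix (Fin n) (Fin n) ℂ[T;T⁻¹]) :
    ev x (ofMat n m) = slProj n (m.map (laurentEval x)) := by
  rw [ofMat_apply, ← sum_smul_e]
  simp only [map_sum, ev_toLoop_tmul]
  rfl

/-! ### Separating tensors by values and by contractions -/

theorem eq_zero_of_laurentEval {p : ℂ[T;T⁻¹]} (x : ℂˣ)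
    (h : ∀ y, y ≠ x → laurentEval y p = 0) : p = 0 := by
  obtain ⟨m, q, hq⟩ := exists_T_pow p
  have hq0 : q = 0 := by
    refine Polynomial.eq_zero_of_infinite_isRoot q ?_
    have : (Set.univ \ {0, (x : ℂ)} : Set ℂ).Infinite :=
      Set.infinite_univ.sdiff (Set.toFinite _)
    refine this.mono ?_
    rintro y ⟨-, hy⟩
    simp only [Set.mem_insert_iff, Set.mem_singleton_iff, not_or] at hy
    let u := Units.mk0 y hy.1
    have h1 : ∀ q : Polynomial ℂ, laurentEval u (Polynomial.toLaurent q) = q.eval y := by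
      intro q
      induction q using Polynomial.induction_on' with
      | add p q hp hq => simp [hp, hq]
      | monomial k c =>
        rw [← Polynomial.C_mul_X_pow_eq_monomial, Polynomial.toLaurent_C_mul_X_pow,
          laurentEval_C_mul_T]
        simp [u]
    change Polynomial.eval y q = 0
    rw [← h1, hq, map_mul, h u (fun hu => hy.2 (congrArg Units.val hu)), zero_mul]
  rw [hq0, map_zero] at hq
  exact ((isUnit_T (R := ℂ) m).mul_left_eq_zero).mp hq.symm

theorem eq_zero_of_ev {f : Loop n} (x : ℂˣ) (h : ∀ y, y ≠ x → ev y f = 0) : f = 0 := by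
  apply mat_injective
  rw [map_zero]
  ext1 i j
  refine eq_zero_of_laurentEval x fun y hy => ?_
  have := congrArg Subtype.val (h y hy)
  rw [val_ev] at this
  exact congrFun (congrFun this i) j

theorem eq_zero_of_lid_rTensor {M N : Type*} [AddCommGroup M] [Module ℂ M] [AddCommGroup N]
    [Module ℂ N] {u : M ⊗[ℂ] N}
    (h : ∀ α : Module.Dual ℂ M, TensorProduct.lid ℂ N (α.rTensor N u) = 0) : u = 0 := by
  classical
  let b := Module.Basis.ofVectorSpace ℂ M
  apply (TensorProduct.equivFinsuppOfBasisLeft b).injective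
  rw [map_zero]
  ext1 i
  have : ∀ u : M ⊗[ℂ] N, TensorProduct.equivFinsuppOfBasisLeft b u i =
      TensorProduct.lid ℂ N ((b.coord i).rTensor N u) := by
    intro u
    induction u using TensorProduct.induction_on with
    | zero => simp
    | add u v hu hv => simp only [map_add, Finsupp.add_apply, hu, hv]
    | tmul m y => simp
  rw [this, h, Finsupp.zero_apply]

theorem eq_zero_of_rTensor_ev {N : Type*} [AddCommGroup N] [Module ℂ N] (x : ℂˣ)
    {u : N ⊗[ℂ] Loop n} (h : ∀ y, y ≠ x → (ev y).lTensor N u = 0) : u = 0 := by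
  refine eq_zero_of_lid_rTensor fun α => eq_zero_of_ev x fun y hy => ?_
  have h1 : ∀ u, ev y (TensorProduct.lid ℂ (Loop n) (α.rTensor (Loop n) u)) =
      TensorProduct.lid ℂ (G n) (α.rTensor (G n) ((ev y).lTensor N u)) := by
    intro u
    induction u using TensorProduct.induction_on with
    | zero => simp
    | add u v hu hv => simp only [map_add, hu, hv]
    | tmul m y => simp
  rw [h1, h y hy, map_zero, map_zero]

/-- Values off the diagonal suffice: for fixed `x` only one value of `y` is excluded, and a Laurent
polynomial with infinitely many zeros vanishes. -/
theorem eq_zero_of_ev₂ {u : Loop n ⊗[ℂ] Loop n} (h : ∀ x y : ℂˣ, x ≠ y → ev₂ x y u = 0) :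
    u = 0 := by
  have h1 : ∀ x : ℂˣ, (ev x).rTensor (Loop n) u = 0 := by
    intro x
    refine eq_zero_of_rTensor_ev x fun y hy => ?_
    rw [← LinearMap.comp_apply, LinearMap.lTensor_comp_rTensor]
    exact h x y hy.symm
  apply (TensorProduct.comm ℂ (Loop n) (Loop n)).injective
  rw [map_zero]
  refine eq_zero_of_rTensor_ev 1 fun x _ => ?_
  have h2 : ∀ u : Loop n ⊗[ℂ] Loop n, (ev x).lTensor (Loop n)
      (TensorProduct.comm ℂ (Loop n) (Loop n) u) =
        TensorProduct.comm ℂ (G n) (Loop n) ((ev x).rTensor (Loop n) u) := by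
    intro u
    induction u using TensorProduct.induction_on with
    | zero => simp
    | add u v hu hv => simp only [map_add, hu, hv]
    | tmul f g => rfl
  rw [h2, h1, map_zero]

/-- The scalar correction contained in `e j i` is invisible here, since loops are traceless. -/
theorem loopForm_eq_coeff (f : Loop n) (k : ℤ) (i j : Fin n) :
    loopForm n (mono (-k) (e j i)) f = (2 * n : ℂ) * (mat n f i j).coeff k := by
  induction f using mono_induction with
  | hadd f f' h h' => simp [h, h', mul_add]
  | hm l a =>
    rw [loopForm_mono, mat_mono, killing_e', Matrix.smul_apply, Matrix.map_apply, smul_eq_mul,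
      mul_comm (T l), ← smul_eq_C_mul]
    simp [neg_add_eq_zero, eq_comm]

theorem eq_zero_of_loopForm (hn : n ≠ 0) {f : Loop n} (h : ∀ g, loopForm n g f = 0) : f = 0 := by
  apply mat_injective
  rw [map_zero]
  ext1 i j
  ext k
  have := h (mono (-k) (e j i))
  rw [loopForm_eq_coeff, mul_eq_zero] at this
  exact this.resolve_left (two_mul_natCast_ne_zero hn)

theorem eq_zero_of_contr_loopForm (hn : n ≠ 0) {N : Type*} [AddCommGroup N] [Module ℂ N]
    {u : N ⊗[ℂ] Loop n} (h : ∀ g, contr N (loopForm n) g u = 0) : u = 0 := by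
  refine eq_zero_of_lid_rTensor fun α => eq_zero_of_loopForm hn fun g => ?_
  have h1 : ∀ u : N ⊗[ℂ] Loop n,
      loopForm n g (TensorProduct.lid ℂ (Loop n) (α.rTensor (Loop n) u)) =
      α (contr N (loopForm n) g u) := by
    intro u
    induction u using TensorProduct.induction_on with
    | zero => simp
    | add u v hu hv => simp only [map_add, hu, hv]
    | tmul m y => simp [mul_comm]
  rw [h1, h, map_zero]

end LoopAlgebra

/-! ### The operator attached to an `r`-matrix -/

section Operator

open LaurentPolynomial

variable {n : ℕ}

/-- The degree `k` part of the operator attached to the expansion of `r₀` at `y = ∞`. -/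
def rho (n : ℕ) (k : ℤ) : G n →ₗ[ℂ] G n :=
  (if k = 0 then lowerPart n else 0) - if 0 ≤ k then LinearMap.id else 0

theorem rho_of_neg {k : ℤ} (hk : k < 0) (a : G n) : rho n k a = 0 := by
  simp [rho, hk.ne, hk.not_ge]

theorem rho_zero (a : G n) : rho n 0 a = lowerPart n a - a := by
  simp [rho]

theorem rho_of_pos {k : ℤ} (hk : 0 < k) (a : G n) : rho n k a = -a := by
  simp [rho, hk.ne', hk.le]

/-- Degree by degree, this is the Rota–Baxter identity of weight `1`. In degree zero it is
`lowerPart_lie` after replacing `lowerPart` by `lowerPart - 1`; elsewhere `rho` is `0` or `-1`. -/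
theorem rho_lie (k l : ℤ) (a b : G n) : ⁅rho n k a, rho n l b⁆ =
    rho n (k + l) (⁅a, rho n l b⁆ + ⁅rho n k a, b⁆ + ⁅a, b⁆) := by
  rcases lt_trichotomy k 0 with hk | rfl | hk <;> rcases lt_trichotomy l 0 with hl | rfl | hl
  · simp [rho_of_neg hk, rho_of_neg hl, rho_of_neg (add_neg hk hl)]
  · simp [rho_of_neg hk]
  · simp [-lie_skew, rho_of_neg hk, rho_of_pos hl]
  · simp [rho_of_neg hl]
  · have h := lowerPart_lie a b
    simp only [map_sub, map_add] at h
    simp only [add_zero, rho_zero, sub_lie, lie_sub, map_add, map_sub, h]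
    abel
  · rw [zero_add, rho_of_pos hl, rho_of_pos hl, rho_zero, sub_lie, lie_neg, lie_neg, sub_lie]
    abel
  · simp [-lie_skew, rho_of_neg hl, rho_of_pos hk]
  · rw [add_zero, rho_of_pos hk, rho_of_pos hk, rho_zero, lie_sub, neg_lie, neg_lie, lie_sub]
    abel
  · rw [rho_of_pos hk, rho_of_pos hl, rho_of_pos (add_pos hk hl)]
    simp only [neg_lie, lie_neg, neg_neg]
    abel

/-- The operator attached to the expansion of `r₀` at `y = ∞`. -/
def stdOp (n : ℕ) : Loop n →ₗ[ℂ] Loop n := loopLift fun k => mono k ∘ₗ rho n k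

theorem stdOp_mono (k : ℤ) (a : G n) : stdOp n (mono k a) = mono k (rho n k a) :=
  loopLift_mono _ _ _

theorem stdOp_lie (f g : Loop n) :
    ⁅stdOp n f, stdOp n g⁆ = stdOp n (⁅f, stdOp n g⁆ + ⁅stdOp n f, g⁆ + ⁅f, g⁆) := by
  induction f using mono_induction with
  | hadd f f' h h' =>
    simp only [add_lie, map_add] at h h' ⊢
    rw [h, h']
    abel
  | hm k a =>
    induction g using mono_induction with
    | hadd g g' h h' =>
      simp only [lie_add, map_add] at h h' ⊢
      rw [h, h']
      abel
    | hm l b => simp only [stdOp_mono, mono_lie, ← map_add, rho_lie]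

theorem killing_rho (k : ℤ) (a b : G n) :
    killing n (rho n k a) b + killing n a (rho n (-k) b) = -killing n a b := by
  rcases lt_trichotomy k 0 with hk | rfl | hk
  · rw [rho_of_neg hk, rho_of_pos (neg_pos.mpr hk)]
    simp
  · rw [neg_zero, rho_zero, rho_zero, map_sub, LinearMap.sub_apply, map_sub]
    linear_combination killing_lowerPart a b
  · rw [rho_of_pos hk, rho_of_neg (neg_neg_of_pos hk)]
    simp

/-- Operator form of the skew-symmetry of `r₀`. The defect `-1` appears because the flip exchanges
the expansions at `y = ∞` and at `x = ∞`. -/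
theorem loopForm_stdOp (f g : Loop n) :
    loopForm n (stdOp n f) g + loopForm n f (stdOp n g) = -loopForm n f g := by
  induction f using mono_induction with
  | hadd f f' h h' =>
    simp only [map_add, LinearMap.add_apply]
    linear_combination h + h'
  | hm k a =>
    induction g using mono_induction with
    | hadd g g' h h' =>
      simp only [map_add]
      linear_combination h + h'
    | hm l b =>
      simp only [stdOp_mono, loopForm_mono]
      split_ifs with h
      · obtain rfl : l = -k := by omega
        exact killing_rho k a b
      · simp

theorem contr_map_mono (w : G n ⊗[ℂ] G n) (i j l : ℤ) (b : G n) :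
    contr (Loop n) (loopForm n) (mono l b) (TensorProduct.map (mono i) (mono j) w) =
      if l + j = 0 then mono i (contr (G n) (killing n) b w) else 0 := by
  induction w using TensorProduct.induction_on with
  | zero => simp
  | add u v hu hv =>
    simp only [map_add, hu, hv]
    split_ifs <;> simp
  | tmul c d =>
    rw [TensorProduct.map_tmul, contr_tmul, loopForm_mono, contr_tmul]
    split_ifs <;> simp

theorem map_toLoop_tensorTensorTensorComm (i j : ℤ) (w : G n ⊗[ℂ] G n) :
    TensorProduct.map (toLoop n).toLinearMap (toLoop n).toLinearMap
      (TensorProduct.tensorTensorTensorComm ℂ ℂ[T;T⁻¹] ℂ[T;T⁻¹] (G n) (G n)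
        ((T i ⊗ₜ[ℂ] T j) ⊗ₜ[ℂ] w)) = TensorProduct.map (mono i) (mono j) w := by
  induction w using TensorProduct.induction_on with
  | zero => simp
  | add u v hu hv => simp only [TensorProduct.tmul_add, map_add, hu, hv]
  | tmul a b => rfl

theorem δ₀_mono (k : ℤ) (a : G n) : δ₀ n (mono k a) =
    coboundary (TensorProduct.map (mono 0) (mono 0) (rConst n)) (mono k a) +
      (∑ j ∈ Finset.Ico 0 k, TensorProduct.map (mono j) (mono (k - j)) (adCasimir n a) -
        ∑ j ∈ Finset.Ico k 0, TensorProduct.map (mono j) (mono (k - j)) (adCasimir n a)) := by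
  rw [δ₀, LinearMap.add_apply, const_eq, ← rConst]
  congr 1
  simp only [LinearMap.comp_apply, LinearEquiv.coe_coe, mono_apply, LinearEquiv.symm_apply_apply,
    TensorProduct.map_tmul, divDiff_T, TensorProduct.sub_tmul, TensorProduct.sum_tmul, map_sub,
    map_sum, map_toLoop_tensorTensorTensorComm]

theorem contr_adCasimir (hn : n ≠ 0) (a b : G n) :
    contr (G n) (killing n) b (adCasimir n a) = ⁅a, b⁆ := by
  have h : ∀ w : G n ⊗[ℂ] G n, contr (G n) (killing n) b
      ((LieAlgebra.ad ℂ (G n) a).rTensor (G n) w) = ⁅a, contr (G n) (killing n) b w⁆ := by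
    intro w
    induction w using TensorProduct.induction_on with
    | zero => simp
    | add u v hu hv => simp only [map_add, hu, hv, lie_add]
    | tmul c d => simp
  change contr (G n) (killing n) b ((LieAlgebra.ad ℂ (G n) a).rTensor (G n) (casimir n)) = _
  rw [h, contr_casimir hn]

/-- Since `δ₀ f` is the commutator of `f` with `r₀`, its operator is the commutator of `ad f` with
the operator of `r₀`. The expansion of `r₀` is infinite, so the identity is checked on monomials. -/
theorem contr_δ₀ (hn : n ≠ 0) (f g : Loop n) :
    contr (Loop n) (loopForm n) g (δ₀ n f) = ⁅f, stdOp n g⁆ - stdOp n ⁅f, g⁆ := by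
  induction f using mono_induction with
  | hadd f f' h h' =>
    simp only [map_add, add_lie, h, h']
    abel
  | hm k a =>
    induction g using mono_induction with
    | hadd g g' h h' =>
      simp only [contr_add, lie_add, map_add, h, h']
      abel
    | hm l b =>
      have hsum : ∀ s : Finset ℤ, ∑ j ∈ s, contr (Loop n) (loopForm n) (mono l b)
          (TensorProduct.map (mono j) (mono (k - j)) (adCasimir n a)) =
            if k + l ∈ s then mono (k + l) ⁅a, b⁆ else 0 := by
        intro s
        simp only [contr_map_mono, contr_adCasimir hn]
        rw [← Finset.sum_ite_eq s (k + l) fun j => mono j ⁅a, b⁆]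
        refine Finset.sum_congr rfl fun j _ => ?_
        congr 1
        rw [eq_iff_iff]
        omega
      rw [δ₀_mono, map_add, contr_coboundary loopForm_symm loopForm_lie, map_sub, map_sum, map_sum,
        hsum, hsum, mono_lie, contr_map_mono, contr_map_mono, contr_rConst hn, contr_rConst hn,
        stdOp_mono, stdOp_mono, mono_lie, add_zero, add_zero]
      have h0 : ∀ c : G n, ⁅mono k a, if l = 0 then mono 0 c else 0⁆ =
          if l = 0 then mono (k + l) ⁅a, c⁆ else 0 := by
        intro c
        split_ifs with h
        · rw [mono_lie, h]
        · simp
      have h1 : ∀ c : G n, (if k + l = 0 then mono 0 c else 0) =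
          if k + l = 0 then mono (k + l) c else 0 := by
        intro c
        split_ifs with h
        · rw [h]
        · rfl
      rw [h0, h1]
      have h2 : mono (k + l) ⁅a, rho n l b⁆ =
          (if l = 0 then mono (k + l) ⁅a, lowerPart n b⁆ else 0) -
            if 0 ≤ l then mono (k + l) ⁅a, b⁆ else 0 := by
        rw [rho, LinearMap.sub_apply, lie_sub, map_sub]
        split_ifs <;> simp
      have h3 : mono (k + l) (rho n (k + l) ⁅a, b⁆) =
          (if k + l = 0 then mono (k + l) (lowerPart n ⁅a, b⁆) else 0) -
            if 0 ≤ k + l then mono (k + l) ⁅a, b⁆ else 0 := by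
        rw [rho, LinearMap.sub_apply, map_sub]
        split_ifs <;> simp
      -- The finite sums in `divDiff` are differences of two half-infinite ones, which are the `0 ≤
      -- ·` parts of `rho` in degrees `k + l` and `l`.
      have h4 : ((if k + l ∈ Finset.Ico 0 k then mono (k + l) ⁅a, b⁆ else 0) -
          if k + l ∈ Finset.Ico k 0 then mono (k + l) ⁅a, b⁆ else 0) =
          (if 0 ≤ k + l then mono (k + l) ⁅a, b⁆ else 0) -
            if 0 ≤ l then mono (k + l) ⁅a, b⁆ else 0 := by
        simp only [Finset.mem_Ico]
        split_ifs <;> first | omega | simp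
      rw [h2, h3, h4]
      abel

theorem flip_δ₀ (f : Loop n) : flip (Loop n) (δ₀ n f) = -δ₀ n f := by
  rw [eq_neg_iff_add_eq_zero, add_comm]
  refine eq_zero_of_ev₂ fun x y hxy => ?_
  rw [map_add, ev₂_flip, ev₂_δ₀ f x y hxy, ev₂_δ₀ f y x hxy.symm]
  have h1 : ∀ (φ : G n →ₗ[ℂ] G n) (r : G n ⊗[ℂ] G n),
      flip (G n) (φ.rTensor (G n) r) = φ.lTensor (G n) (flip (G n) r) := by
    intro φ r
    induction r using TensorProduct.induction_on with
    | zero => simp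
    | add r s hr hs => simp only [map_add, hr, hs]
    | tmul a b => rfl
  have h2 : ∀ (φ : G n →ₗ[ℂ] G n) (r : G n ⊗[ℂ] G n),
      flip (G n) (φ.lTensor (G n) r) = φ.rTensor (G n) (flip (G n) r) := by
    intro φ r
    rw [← flip_flip (φ.rTensor (G n) (flip (G n) r)), h1, flip_flip]
  rw [map_add, h1, h2, eq_neg_of_add_eq_zero_right (r₀_add_flip hxy), map_neg, map_neg]
  abel

/-- The operator `g ↦ (1 ⊗ B(g, ·)) t`. -/
def contrOp (t : Loop n ⊗[ℂ] Loop n) : Loop n →ₗ[ℂ] Loop n where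
  toFun g := contr (Loop n) (loopForm n) g t
  map_add' g h := contr_add _ g h t
  map_smul' c g := contr_smul _ c g t

theorem contrOp_apply (t : Loop n ⊗[ℂ] Loop n) (g : Loop n) :
    contrOp t g = contr (Loop n) (loopForm n) g t := rfl

theorem contr_contr_cyc (s : Loop n ⊗[ℂ] Loop n) (b g h : Loop n) :
    contr (Loop n) (loopForm n) g (contr (Loop n ⊗[ℂ] Loop n) (loopForm n) h
      (cyc (Loop n) (s ⊗ₜ[ℂ] b))) =
        loopForm n g b • contr (Loop n) (loopForm n) h (flip (Loop n) s) := by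
  induction s using TensorProduct.induction_on with
  | zero => simp
  | add s t hs ht => simp only [TensorProduct.add_tmul, map_add, hs, ht, smul_add]
  | tmul p q =>
    rw [cyc_tmul, flip_tmul, contr_tmul, contr_tmul, map_smul, contr_tmul, smul_comm]

theorem contr_contr_cyc_cyc (s : Loop n ⊗[ℂ] Loop n) (b g h : Loop n) :
    contr (Loop n) (loopForm n) g (contr (Loop n ⊗[ℂ] Loop n) (loopForm n) h
      (cyc (Loop n) (cyc (Loop n) (s ⊗ₜ[ℂ] b)))) =
        loopForm n g (contr (Loop n) (loopForm n) h s) • b := by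
  induction s using TensorProduct.induction_on with
  | zero => simp
  | add s t hs ht => simp only [TensorProduct.add_tmul, map_add, hs, ht, add_smul]
  | tmul p q =>
    rw [cyc_tmul, cyc_tmul, contr_tmul, contr_tmul, map_smul, map_smul, contr_tmul, smul_smul,
      smul_eq_mul]

theorem contr_contr_Alt (hn : n ≠ 0) (t : Loop n ⊗[ℂ] Loop n) (g h : Loop n) :
    contr (Loop n) (loopForm n) g (contr (Loop n ⊗[ℂ] Loop n) (loopForm n) h
      (Alt ((δ₀ n).rTensor (Loop n) t))) =
      ⁅contrOp t h, stdOp n g⁆ - stdOp n ⁅contrOp t h, g⁆ -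
        (⁅contrOp t g, stdOp n h⁆ - stdOp n ⁅contrOp t g, h⁆) +
        contrOp (flip (Loop n) t) (⁅stdOp n h, g⁆ + ⁅h, g⁆ + ⁅h, stdOp n g⁆) := by
  simp only [contrOp_apply]
  induction t using TensorProduct.induction_on with
  | zero => simp [Alt]
  | add s t hs ht =>
    simp only [Alt, map_add, add_lie] at hs ht ⊢
    linear_combination (norm := abel) hs + ht
  | tmul a b =>
    rw [LinearMap.rTensor_tmul, Alt, map_add, map_add, map_add, map_add, contr_contr_cyc,
      contr_contr_cyc_cyc, contr_tmul, map_smul, flip_δ₀, map_neg, contr_δ₀ hn, contr_δ₀ hn,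
      flip_tmul, contr_tmul, contr_tmul, contr_tmul]
    have h1 : loopForm n g (⁅a, stdOp n h⁆ - stdOp n ⁅a, h⁆) =
        loopForm n (⁅stdOp n h, g⁆ + ⁅h, g⁆ + ⁅h, stdOp n g⁆) a := by
      -- Transposing `stdOp` and moving `ad a` across the form isolates `a`; the defect `-1` in the
      -- transposition produces the bracket `⁅h, g⁆`.
      have := loopForm_stdOp g ⁅a, h⁆
      simp only [map_sub, map_add, LinearMap.add_apply,
        form_lie_cyclic loopForm_symm loopForm_lie _ _ a]
      linear_combination -this
    rw [h1]
    simp only [smul_lie, map_smul]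
    module

/-- The operator attached to the expansion of `r₀ + t` at `y = ∞`. -/
def rOp (t : Loop n ⊗[ℂ] Loop n) : Loop n →ₗ[ℂ] Loop n := stdOp n + contrOp t

theorem rOp_apply (t : Loop n ⊗[ℂ] Loop n) (g : Loop n) :
    rOp t g = stdOp n g + contrOp t g := rfl

/-- Contracting the twist equation gives the part of the identity involving `contrOp t`; the part
free of `t` is `stdOp_lie`. In consequence the range of `rOp t` is closed under brackets. -/
theorem rOp_lie (hn : n ≠ 0) {t : Loop n ⊗[ℂ] Loop n} (ht : IsClassicalTwist (δ₀ n) t)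
    (g h : Loop n) : ⁅rOp t g, rOp t h⁆ = rOp t (⁅g, rOp t h⁆ + ⁅rOp t g, h⁆ + ⁅g, h⁆) := by
  obtain ⟨hskew, hcyb⟩ := ht
  have hflip : flip (Loop n) t = -t := eq_neg_of_add_eq_zero_right hskew
  have hneg : ∀ f, contr (Loop n) (loopForm n) f (-t) = -contrOp t f := fun f => map_neg _ _
  have h1 := congrArg (fun u => contr (Loop n) (loopForm n) g
    (contr (Loop n ⊗[ℂ] Loop n) (loopForm n) h u)) hcyb
  simp only [contr_contr_Alt hn, CYB, lie1213_eq, lie1223_eq, lie1323_eq, map_add,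
    contr_bilin1213, contr_bilin1223 loopForm_symm loopForm_lie,
    contr_bilin1323 loopForm_symm loopForm_lie, hflip, hneg] at h1
  simp only [← contrOp_apply] at h1
  have h2 := stdOp_lie g h
  simp only [rOp_apply, map_add, lie_add, add_lie] at h1 h2 ⊢
  have e1 : ∀ f, contrOp (-t) f = -contrOp t f := hneg
  simp only [e1, neg_lie, map_neg] at h1
  have s1 := (lie_skew (contrOp t h) g).symm
  have s2 := (lie_skew (contrOp t h) (stdOp n g)).symm
  have s3 := (lie_skew h (stdOp n g)).symm
  have s4 := (lie_skew (stdOp n h) g).symm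
  have s5 := (lie_skew h g).symm
  simp only [s1, s2, s3, s4, s5, map_neg] at h1 h2 ⊢
  linear_combination (norm := abel) h1 + h2

end Operator

/-! ### Gauging the range of the operator into `𝔤[z]` -/

section Gauge

open LaurentPolynomial Polynomial

variable {n : ℕ}

/-! ### Pole bounds for the range of the operator -/

theorem mat_mono_mem_boundedMatrices {k : ℤ} {m : ℕ} (h : -(m : ℤ) ≤ k) (a : G n) :
    mat n (mono k a) ∈ boundedMatrices n m := by
  refine ⟨(X ^ (k + m).toNat : ℂ[X]) • a.val.map Polynomial.C, ?_⟩
  rw [mat_mono]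
  ext1 i j
  simp only [Matrix.smul_apply, Matrix.map_apply, smul_eq_mul, map_mul, toLaurent_X_pow,
    toLaurent_C, ← mul_assoc, ← T_add]
  congr 2
  omega

theorem exists_mat_mem_boundedMatrices (f : Loop n) : ∃ m, mat n f ∈ boundedMatrices n m := by
  induction f using mono_induction with
  | hm k a => exact ⟨k.natAbs, mat_mono_mem_boundedMatrices (by omega) a⟩
  | hadd f g hf hg =>
    obtain ⟨l, hl⟩ := hf
    obtain ⟨m, hm⟩ := hg
    refine ⟨max l m, ?_⟩
    rw [map_add]
    exact add_mem (boundedMatrices_mono (le_max_left l m) hl)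
      (boundedMatrices_mono (le_max_right l m) hm)

theorem mat_stdOp_mem_boundedMatrices (g : Loop n) (m : ℕ) :
    mat n (stdOp n g) ∈ boundedMatrices n m := by
  induction g using mono_induction with
  | hm k a =>
    rw [stdOp_mono]
    rcases lt_or_ge k 0 with hk | hk
    · rw [rho_of_neg hk, map_zero, map_zero]
      exact zero_mem _
    · exact mat_mono_mem_boundedMatrices (by omega) _
  | hadd f g hf hg =>
    rw [map_add, map_add]
    exact add_mem hf hg

theorem exists_mat_contrOp_mem_boundedMatrices (t : Loop n ⊗[ℂ] Loop n) :
    ∃ m, ∀ g, mat n (contrOp t g) ∈ boundedMatrices n m := by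
  simp only [contrOp_apply]
  induction t using TensorProduct.induction_on with
  | zero => exact ⟨0, fun g => by rw [map_zero, map_zero]; exact zero_mem _⟩
  | tmul a b =>
    obtain ⟨m, hm⟩ := exists_mat_mem_boundedMatrices a
    refine ⟨m, fun g => ?_⟩
    rw [contr_tmul, map_smul]
    exact ((boundedMatrices n m).restrictScalars ℂ).smul_mem _ hm
  | add s t hs ht =>
    obtain ⟨l, hl⟩ := hs
    obtain ⟨m, hm⟩ := ht
    refine ⟨max l m, fun g => ?_⟩
    rw [map_add, map_add]
    exact add_mem (boundedMatrices_mono (le_max_left l m) (hl g))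
      (boundedMatrices_mono (le_max_right l m) (hm g))

theorem exists_loopForm_mono_eq_zero (f : Loop n) :
    ∃ N : ℕ, ∀ l : ℤ, N ≤ l → ∀ b, loopForm n (mono l b) f = 0 := by
  induction f using mono_induction with
  | hm k a =>
    refine ⟨k.natAbs + 1, fun l hl b => ?_⟩
    rw [loopForm_mono, if_neg (by omega)]
  | hadd f g hf hg =>
    obtain ⟨M, hM⟩ := hf
    obtain ⟨N, hN⟩ := hg
    refine ⟨max M N, fun l hl b => ?_⟩
    rw [map_add, hM l (by omega), hN l (by omega), add_zero]

theorem exists_contrOp_mono_eq_zero (t : Loop n ⊗[ℂ] Loop n) :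
    ∃ N : ℕ, ∀ l : ℤ, N ≤ l → ∀ b, contrOp t (mono l b) = 0 := by
  simp only [contrOp_apply]
  induction t using TensorProduct.induction_on with
  | zero => exact ⟨0, fun l _ b => map_zero _⟩
  | tmul a b =>
    obtain ⟨N, hN⟩ := exists_loopForm_mono_eq_zero b
    refine ⟨N, fun l hl c => ?_⟩
    rw [contr_tmul, hN l hl, zero_smul]
  | add s t hs ht =>
    obtain ⟨M, hM⟩ := hs
    obtain ⟨N, hN⟩ := ht
    refine ⟨max M N, fun l hl b => ?_⟩
    rw [map_add, hM l (by omega), hN l (by omega), add_zero]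

/-- The range of `rOp t` satisfies the hypotheses of `exists_conj_polynomial`. Its poles are bounded
because `stdOp` produces none and `contrOp t` only those of the finitely many first factors of `t`;
it contains all high monomials because there `rOp t` is `-1`. -/
theorem exists_gauge (hn : n ≠ 0) {t : Loop n ⊗[ℂ] Loop n} (ht : IsClassicalTwist (δ₀ n) t) :
    ∃ P Q : Matrix (Fin n) (Fin n) ℂ[T;T⁻¹], Q * P = 1 ∧ P * Q = 1 ∧
      ∀ g, ∃ c : Matrix (Fin n) (Fin n) ℂ[X], Q * mat n (rOp t g) * P = c.map toLaurent := by
  obtain ⟨m, hm⟩ := exists_mat_contrOp_mem_boundedMatrices t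
  obtain ⟨N, hN⟩ := exists_contrOp_mono_eq_zero t
  let W := (LinearMap.range (rOp t)).map (mat n)
  have hmem : ∀ g, mat n (rOp t g) ∈ W := fun g => ⟨_, ⟨g, rfl⟩, rfl⟩
  have hlie : ∀ x ∈ W, ∀ y ∈ W, x * y - y * x ∈ W := by
    rintro _ ⟨_, ⟨g, rfl⟩, rfl⟩ _ ⟨_, ⟨h, rfl⟩, rfl⟩
    rw [← mat_lie, rOp_lie hn ht]
    exact hmem _
  have htr : ∀ x ∈ W, x.trace = 0 := by
    rintro _ ⟨f, -, rfl⟩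
    exact trace_mat f
  have hbd : W ≤ (boundedMatrices n m).restrictScalars ℂ := by
    rintro _ ⟨_, ⟨g, rfl⟩, rfl⟩
    rw [rOp_apply, map_add]
    exact add_mem (mat_stdOp_mem_boundedMatrices g m) (hm g)
  have hgen : ∀ i j, ∃ r : ℂ[T;T⁻¹],
      (T (N + 1 : ℕ) : ℂ[T;T⁻¹]) • Matrix.single i j 1 - r • 1 ∈ W := by
    intro i j
    -- The scalar is the trace correction that makes `e i j` differ from a matrix unit when `i = j`.
    -- The degree `N + 1` is positive even if `N = 0`, so that `stdOp` acts as `-1`.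
    refine ⟨T (N + 1 : ℕ) * LaurentPolynomial.C (Matrix.trace (Matrix.single i j (1 : ℂ)) / n), ?_⟩
    have h1 : rOp t (mono (N + 1 : ℕ) (-e i j)) = mono (N + 1 : ℕ) (e i j) := by
      rw [rOp_apply, hN _ (by push_cast; omega), stdOp_mono, rho_of_pos (by positivity), neg_neg,
        add_zero]
    convert! hmem (mono (N + 1 : ℕ) (-e i j)) using 1
    rw [h1, mat_mono, mul_smul, ← smul_sub]
    congr 1
    have : (e i j : G n).val = Matrix.single i j 1 -
      (Matrix.trace (Matrix.single i j (1 : ℂ)) / n) • (1 : Matrix (Fin n) (Fin n) ℂ) := rfl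
    rw [this]
    ext1 k l
    simp [Matrix.single_apply, Matrix.one_apply, apply_ite LaurentPolynomial.C]
  obtain ⟨P, Q, hQP, hPQ, h⟩ := exists_conj_polynomial hn hlie htr hbd hgen
  exact ⟨P, Q, hQP, hPQ, fun g => h _ (hmem g)⟩

/-- Conjugation by an invertible matrix as an automorphism of `𝔰𝔩(n, ℂ)`. -/
def conjEquiv (p q : Matrix (Fin n) (Fin n) ℂ) (hqp : q * p = 1) (hpq : p * q = 1) :
    G n ≃ₗ⁅ℂ⁆ G n :=
  have htr : ∀ {p q : Matrix (Fin n) (Fin n) ℂ}, p * q = 1 → ∀ a : G n,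
      (q * a.val * p).trace = 0 := fun {p q} hpq a => by
    rw [Matrix.trace_mul_comm, ← mul_assoc, hpq, one_mul, trace_val]
  { toFun := fun a => slProj n (q * a.val * p)
    map_add' := fun a b => by
      rw [← map_add, ← add_mul, ← mul_add]
      rfl
    map_smul' := fun c a => by
      rw [RingHom.id_apply, ← map_smul, ← smul_mul_assoc, ← mul_smul_comm]
      rfl
    map_lie' := fun {a b} => by
      ext1
      rw [LieAlgebra.SpecialLinear.sl_bracket]
      change (slProj n (q * (a.val * b.val - b.val * a.val) * p)).val = _
      have : q * (a.val * b.val - b.val * a.val) * p =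
          q * a.val * p * (q * b.val * p) - q * b.val * p * (q * a.val * p) := by
        have h : ∀ a b : Matrix (Fin n) (Fin n) ℂ, q * a * p * (q * b * p) = q * (a * b) * p := by
          intro a b
          calc q * a * p * (q * b * p) = q * a * (p * q) * b * p := by noncomm_ring
            _ = q * (a * b) * p := by rw [hpq]; noncomm_ring
        rw [h, h, mul_sub, sub_mul]
      change _ = (slProj n _).val * (slProj n _).val - (slProj n _).val * (slProj n _).val
      rw [val_slProj (htr hpq a), val_slProj (htr hpq b), ← this]
      exact val_slProj (htr hpq ⁅a, b⁆)
    invFun := fun a => slProj n (p * a.val * q)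
    left_inv := fun a => by
      ext1
      change (slProj n (p * (slProj n (q * a.val * p)).val * q)).val = _
      rw [val_slProj (htr hpq a)]
      have : p * (q * a.val * p) * q = a.val := by
        calc p * (q * a.val * p) * q = (p * q) * a.val * (p * q) := by noncomm_ring
          _ = a.val := by rw [hpq, one_mul, mul_one]
      rw [this]
      exact val_slProj (trace_val a)
    right_inv := fun a => by
      ext1
      change (slProj n (q * (slProj n (p * a.val * q)).val * p)).val = _
      rw [val_slProj (htr hqp a)]
      have : q * (p * a.val * q) * p = a.val := by
        calc q * (p * a.val * q) * p = (q * p) * a.val * (q * p) := by noncomm_ring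
          _ = a.val := by rw [hqp, one_mul, mul_one]
      rw [this]
      exact val_slProj (trace_val a) }

theorem conjEquiv_apply (p q : Matrix (Fin n) (Fin n) ℂ) (hqp : q * p = 1) (hpq : p * q = 1)
    (a : G n) : conjEquiv p q hqp hpq a = slProj n (q * a.val * p) := rfl

theorem val_conjEquiv (p q : Matrix (Fin n) (Fin n) ℂ) (hqp : q * p = 1) (hpq : p * q = 1)
    (a : G n) : (conjEquiv p q hqp hpq a).val = q * a.val * p := by
  rw [conjEquiv_apply, val_slProj]
  rw [Matrix.trace_mul_comm, ← mul_assoc, hpq, one_mul, trace_val]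

/-- Conjugation preserves the Killing form, so its adjoint is the inverse conjugation. Contracting
with `a` gives `φ (φ⁻¹ a) = a`, the same contraction as for `C`. -/
theorem map_conjEquiv_casimir (hn : n ≠ 0) (p q : Matrix (Fin n) (Fin n) ℂ) (hqp : q * p = 1)
    (hpq : p * q = 1) : TensorProduct.map (conjEquiv p q hqp hpq).toLinearEquiv.toLinearMap
      (conjEquiv p q hqp hpq).toLinearEquiv.toLinearMap (casimir n) = casimir n := by
  set φ := (conjEquiv p q hqp hpq).toLinearEquiv.toLinearMap
  have hφ : ∀ a, φ a = conjEquiv p q hqp hpq a := fun a => rfl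
  rw [← sub_eq_zero]
  refine eq_zero_of_contr_eq_zero hn fun a => ?_
  let b := conjEquiv q p hpq hqp a
  have hK : ∀ c, killing n a (φ c) = killing n b c := by
    intro c
    rw [killing_apply, killing_apply, hφ, val_conjEquiv, val_conjEquiv]
    congr 1
    rw [← mul_assoc, Matrix.trace_mul_comm, ← mul_assoc, ← mul_assoc]
  have h1 : ∀ w : G n ⊗[ℂ] G n, contr (G n) (killing n) a (TensorProduct.map φ φ w) =
      φ (contr (G n) (killing n) b w) := by
    intro w
    induction w using TensorProduct.induction_on with
    | zero => simp
    | add u v hu hv => simp only [map_add, hu, hv]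
    | tmul c d => rw [TensorProduct.map_tmul, contr_tmul, contr_tmul, hK, map_smul]
  rw [map_sub, h1, contr_casimir hn, contr_casimir hn, hφ, sub_eq_zero]
  ext1
  rw [val_conjEquiv, val_conjEquiv]
  calc q * (p * a.val * q) * p = (q * p) * a.val * (q * p) := by noncomm_ring
    _ = a.val := by rw [hqp, one_mul, mul_one]

/-- Conjugation by an invertible matrix over `ℂ[z, z⁻¹]`. -/
def conjLoop (P Q : Matrix (Fin n) (Fin n) ℂ[T;T⁻¹]) : Loop n →ₗ[ℂ] Loop n where
  toFun f := ofMat n (Q * mat n f * P)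
  map_add' f g := by rw [map_add, mul_add, add_mul, map_add]
  map_smul' c f := by rw [map_smul, mul_smul_comm, smul_mul_assoc, map_smul, RingHom.id_apply]

/-- The values of the automorphism `conjLoop`. -/
def conjEv {P Q : Matrix (Fin n) (Fin n) ℂ[T;T⁻¹]} (hQP : Q * P = 1) (hPQ : P * Q = 1) (x : ℂˣ) :
    G n ≃ₗ⁅ℂ⁆ G n :=
  conjEquiv (P.map (laurentEval x)) (Q.map (laurentEval x))
    (by rw [← Matrix.map_mul, hQP, Matrix.map_one _ (map_zero _) (map_one _)])
    (by rw [← Matrix.map_mul, hPQ, Matrix.map_one _ (map_zero _) (map_one _)])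

theorem ev_conjLoop {P Q : Matrix (Fin n) (Fin n) ℂ[T;T⁻¹]} (hQP : Q * P = 1) (hPQ : P * Q = 1)
    (x : ℂˣ) (f : Loop n) : ev x (conjLoop P Q f) = conjEv hQP hPQ x (ev x f) := by
  rw [conjEv, conjEquiv_apply, val_ev, ← Matrix.map_mul, ← Matrix.map_mul]
  exact ev_ofMat x _

theorem ev₂_map_conjLoop {P Q : Matrix (Fin n) (Fin n) ℂ[T;T⁻¹]} (hQP : Q * P = 1)
    (hPQ : P * Q = 1) (x y : ℂˣ) (u : Loop n ⊗[ℂ] Loop n) :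
    ev₂ x y (TensorProduct.map (conjLoop P Q) (conjLoop P Q) u) =
      TensorProduct.map (conjEv hQP hPQ x).toLinearEquiv.toLinearMap
        (conjEv hQP hPQ y).toLinearEquiv.toLinearMap (ev₂ x y u) := by
  induction u using TensorProduct.induction_on with
  | zero => simp
  | add u v hu hv => simp only [map_add, hu, hv]
  | tmul f g =>
    simp only [ev₂, TensorProduct.map_tmul, ev_conjLoop hQP hPQ]
    rfl

/-! ### Truncation to `𝔤[z]` -/

/-- The truncation `𝔤[z, z⁻¹] → 𝔤[z]`. -/
def polyProj (n : ℕ) : Loop n →ₗ[ℂ] ℂ[X] ⊗[ℂ] G n :=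
  loopLift fun k => if 0 ≤ k then TensorProduct.mk ℂ ℂ[X] (G n) (X ^ k.toNat) else 0

/-- The truncation as an endomorphism of `𝔤[z, z⁻¹]`. -/
def truncLoop (n : ℕ) : Loop n →ₗ[ℂ] Loop n := polyIncl n ∘ₗ polyProj n

theorem polyIncl_tmul (p : ℂ[X]) (a : G n) :
    polyIncl n (p ⊗ₜ[ℂ] a) = toLoop n (toLaurent p ⊗ₜ[ℂ] a) := rfl

theorem truncLoop_mono {k : ℤ} (hk : 0 ≤ k) (a : G n) : truncLoop n (mono k a) = mono k a := by
  rw [truncLoop, LinearMap.comp_apply, polyProj, loopLift_mono, if_pos hk, TensorProduct.mk_apply,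
    polyIncl_tmul, toLaurent_X_pow, Int.toNat_of_nonneg hk, mono_apply]

theorem truncLoop_polyIncl (q : ℂ[X] ⊗[ℂ] G n) :
    truncLoop n (polyIncl n q) = polyIncl n q := by
  induction q using TensorProduct.induction_on with
  | zero => simp
  | add p q hp hq => simp only [map_add, hp, hq]
  | tmul p a =>
    induction p using Polynomial.induction_on' with
    | add p q hp hq => simp only [TensorProduct.add_tmul, map_add, hp, hq]
    | monomial k c =>
      have : polyIncl n (Polynomial.monomial k c ⊗ₜ[ℂ] a) = mono (k : ℤ) (c • a) := by
        rw [polyIncl_tmul, ← Polynomial.C_mul_X_pow_eq_monomial, toLaurent_C_mul_X_pow,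
          ← LaurentPolynomial.smul_eq_C_mul, TensorProduct.smul_tmul, mono_apply]
      rw [this, truncLoop_mono (Int.natCast_nonneg k)]

theorem ofMat_map_toLaurent (c : Matrix (Fin n) (Fin n) ℂ[X]) :
    ofMat n (c.map toLaurent) = polyIncl n (∑ i, ∑ j, c i j ⊗ₜ[ℂ] e i j) := by
  rw [ofMat_apply, map_sum]
  refine Finset.sum_congr rfl fun i _ => ?_
  rw [map_sum]
  rfl

end Gauge

/-! ### The gauged `r`-matrix is quasi-trigonometric -/

section Main

open LaurentPolynomial Polynomial

variable {n : ℕ}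

theorem ev₂_map_mono (x y : ℂˣ) (i j : ℤ) (w : G n ⊗[ℂ] G n) :
    ev₂ x y (TensorProduct.map (mono i) (mono j) w) = ((x : ℂ) ^ i * (y : ℂ) ^ j) • w := by
  induction w using TensorProduct.induction_on with
  | zero => simp
  | add u v hu hv => simp only [map_add, hu, hv, smul_add]
  | tmul a b =>
    rw [TensorProduct.map_tmul, ev₂, TensorProduct.map_tmul, ev_mono, ev_mono,
      TensorProduct.smul_tmul_smul]

theorem truncLoop_rTensor_map_mono {i : ℤ} (hi : 0 ≤ i) (j : ℤ) (w : G n ⊗[ℂ] G n) :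
    (truncLoop n).rTensor (Loop n) (TensorProduct.map (mono i) (mono j) w) =
      TensorProduct.map (mono i) (mono j) w := by
  induction w using TensorProduct.induction_on with
  | zero => simp
  | add u v hu hv => simp only [map_add, hu, hv]
  | tmul a b => rw [TensorProduct.map_tmul, LinearMap.rTensor_tmul, truncLoop_mono hi]

/-- `u ^ K / (u - 1)` times a difference of values is a Laurent polynomial in `x, y`, and a
polynomial in `x` if `K` is large; here `u = x / y`. -/
theorem exists_divided_difference (f g : Loop n) : ∃ K₀ : ℕ, ∀ K : ℕ, K₀ ≤ K →
    ∃ q : Loop n ⊗[ℂ] Loop n, (truncLoop n).rTensor (Loop n) q = q ∧ ∀ x y : ℂˣ, x ≠ y →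
      ev₂ x y q = (((x : ℂ) / y) ^ K * (1 / ((x : ℂ) / y - 1))) •
        (ev x g ⊗ₜ[ℂ] (ev y f - ev x f)) := by
  induction f using mono_induction with
  | hadd f f' h h' =>
    obtain ⟨A, hA⟩ := h
    obtain ⟨B, hB⟩ := h'
    refine ⟨max A B, fun K hK => ?_⟩
    obtain ⟨q, hq, hq'⟩ := hA K (le_of_max_le_left hK)
    obtain ⟨s, hs, hs'⟩ := hB K (le_of_max_le_right hK)
    refine ⟨q + s, by rw [map_add, hq, hs], fun x y hxy => ?_⟩
    rw [map_add, hq' x y hxy, hs' x y hxy, ← smul_add, ← TensorProduct.tmul_add, map_add, map_add,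
      add_sub_add_comm]
  | hm l b =>
    induction g using mono_induction with
    | hadd g g' h h' =>
      obtain ⟨A, hA⟩ := h
      obtain ⟨B, hB⟩ := h'
      refine ⟨max A B, fun K hK => ?_⟩
      obtain ⟨q, hq, hq'⟩ := hA K (le_of_max_le_left hK)
      obtain ⟨s, hs, hs'⟩ := hB K (le_of_max_le_right hK)
      refine ⟨q + s, by rw [map_add, hq, hs], fun x y hxy => ?_⟩
      rw [map_add, hq' x y hxy, hs' x y hxy, ← smul_add, ← TensorProduct.add_tmul, map_add]
    | hm k a =>
      -- The powers of `x` that occur are `k + K + j` with `j ≥ min l 0`, so this bound makes them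
      -- nonnegative.
      refine ⟨k.natAbs + l.natAbs, fun K hK => ?_⟩
      let F : ℤ → Loop n ⊗[ℂ] Loop n := fun j =>
        TensorProduct.map (mono (k + K + j)) (mono (l - j - K)) (a ⊗ₜ[ℂ] b)
      refine ⟨∑ j ∈ Finset.Ico l 0, F j - ∑ j ∈ Finset.Ico 0 l, F j, ?_, fun x y hxy => ?_⟩
      · rw [map_sub, map_sum, map_sum]
        congr 1 <;>
        · refine Finset.sum_congr rfl fun j hj => truncLoop_rTensor_map_mono ?_ _ _
          rw [Finset.mem_Ico] at hj
          omega
      · have hx := x.ne_zero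
        have hy := y.ne_zero
        have hF : ∀ j, ev₂ x y (F j) =
            (((x : ℂ) / y) ^ K * (x : ℂ) ^ k * ((x : ℂ) ^ j * (y : ℂ) ^ (l - j))) • a ⊗ₜ[ℂ] b := by
          intro j
          rw [ev₂_map_mono, zpow_add₀ hx, zpow_add₀ hx, zpow_sub₀ hy _ (K : ℤ), zpow_natCast,
            zpow_natCast, div_pow]
          congr 1
          field_simp
        rw [map_sub, map_sum, map_sum]
        simp only [hF]
        rw [← Finset.sum_smul, ← Finset.sum_smul, ← Finset.mul_sum, ← Finset.mul_sum, ← sub_smul,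
          ← mul_sub, ← neg_sub (∑ j ∈ Finset.Ico 0 l, _), geom_zpow x y hxy, ev_mono, ev_mono,
          ev_mono, ← sub_smul, TensorProduct.smul_tmul_smul, smul_smul]
        congr 1
        ring

theorem map_casimir_sub (φ ψ : G n →ₗ[ℂ] G n) :
    TensorProduct.map φ ψ (casimir n) - TensorProduct.map φ φ (casimir n) =
      (2 * n : ℂ)⁻¹ • ∑ i, ∑ j, φ (e i j) ⊗ₜ[ℂ] (ψ (e j i) - φ (e j i)) := by
  simp only [casimir, map_smul, map_sum, TensorProduct.map_tmul, ← smul_sub,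
    ← Finset.sum_sub_distrib, TensorProduct.tmul_sub]

/-- Since `φ(x) ⊗ φ(x)` fixes `C`, the difference is a sum of terms `φ(x) a ⊗ (φ(y) b - φ(x) b)`.
Each vanishes on the diagonal, and so absorbs the pole. -/
theorem exists_divided_difference_casimir (hn : n ≠ 0) {P Q : Matrix (Fin n) (Fin n) ℂ[T;T⁻¹]}
    (hQP : Q * P = 1) (hPQ : P * Q = 1) : ∃ K₀ : ℕ, ∀ K : ℕ, K₀ ≤ K →
    ∃ q : Loop n ⊗[ℂ] Loop n, (truncLoop n).rTensor (Loop n) q = q ∧ ∀ x y : ℂˣ, x ≠ y →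
      ev₂ x y q = (((x : ℂ) / y) ^ K * (1 / ((x : ℂ) / y - 1))) •
        (TensorProduct.map (conjEv hQP hPQ x).toLinearEquiv.toLinearMap
          (conjEv hQP hPQ y).toLinearEquiv.toLinearMap (casimir n) - casimir n) := by
  choose A hA using fun i j : Fin n =>
    exists_divided_difference (conjLoop P Q (mono 0 (e j i))) (conjLoop P Q (mono 0 (e i j)))
  refine ⟨∑ i, ∑ j, A i j, fun K hK => ?_⟩
  have hle : ∀ i j, A i j ≤ K := fun i j =>
    ((Finset.single_le_sum (f := fun j => A i j) (fun _ _ => Nat.zero_le _)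
      (Finset.mem_univ j)).trans (Finset.single_le_sum (f := fun i => ∑ j, A i j)
        (fun _ _ => Nat.zero_le _) (Finset.mem_univ i))).trans hK
  choose q hq hq' using fun i j => hA i j K (hle i j)
  refine ⟨(2 * n : ℂ)⁻¹ • ∑ i, ∑ j, q i j, ?_, fun x y hxy => ?_⟩
  · simp only [map_smul, map_sum, hq]
  · have hinv : TensorProduct.map (conjEv hQP hPQ x).toLinearEquiv.toLinearMap
        (conjEv hQP hPQ x).toLinearEquiv.toLinearMap (casimir n) = casimir n :=
      map_conjEquiv_casimir hn _ _ _ _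
    have key := map_casimir_sub (conjEv hQP hPQ x).toLinearEquiv.toLinearMap
      (conjEv hQP hPQ y).toLinearEquiv.toLinearMap
    rw [hinv] at key
    rw [key, smul_comm, map_smul, map_sum]
    congr 1
    rw [Finset.smul_sum]
    refine Finset.sum_congr rfl fun i _ => ?_
    rw [map_sum, Finset.smul_sum]
    refine Finset.sum_congr rfl fun j _ => ?_
    rw [hq' i j x y hxy]
    simp only [ev_conjLoop hQP hPQ, ev_mono, zpow_zero, one_smul]
    rfl

/-- A tensor all of whose contractions lie in `𝔤[z]` is polynomial in the first variable. -/
theorem truncLoop_rTensor_eq_self (hn : n ≠ 0) {u : Loop n ⊗[ℂ] Loop n}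
    (hu : ∀ g, truncLoop n (contr (Loop n) (loopForm n) g u) = contr (Loop n) (loopForm n) g u) :
    (truncLoop n).rTensor (Loop n) u = u := by
  rw [← sub_eq_zero]
  refine eq_zero_of_contr_loopForm hn fun g => ?_
  have h : ∀ u : Loop n ⊗[ℂ] Loop n, contr (Loop n) (loopForm n) g
      ((truncLoop n).rTensor (Loop n) u) = truncLoop n (contr (Loop n) (loopForm n) g u) := by
    intro u
    induction u using TensorProduct.induction_on with
    | zero => simp
    | add u v hu hv => simp only [map_add, hu, hv]
    | tmul m y => simp
  rw [map_sub, h, hu, sub_self]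

/-- The part of the expansion of `r₀ + t` at `y = ∞` up to order `K`. -/
def expansion (t : Loop n ⊗[ℂ] Loop n) (K : ℕ) : Loop n ⊗[ℂ] Loop n :=
  TensorProduct.map (mono 0) (mono 0) (rConst n) + t -
    ∑ k ∈ Finset.range K, TensorProduct.map (mono k) (mono (-k)) (casimir n)

/-- From the finite geometric sum, `1 / (u - 1)` is `u ^ K / (u - 1)` minus the powers of `u` below
`K`. -/
theorem rMatrix_eq_expansion (t : Loop n ⊗[ℂ] Loop n) (K : ℕ) {x y : ℂˣ} (hxy : x ≠ y) :
    rMatrix t x y = ev₂ x y (expansion t K) +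
      (((x : ℂ) / y) ^ K * (1 / ((x : ℂ) / y - 1))) • casimir n := by
  have hu := div_sub_one_ne_zero hxy
  have hsum : ∑ k ∈ Finset.range K, ((x : ℂ) ^ (k : ℤ) * (y : ℂ) ^ (-(k : ℤ))) • casimir n =
      ((((x : ℂ) / y) ^ K - 1) / ((x : ℂ) / y - 1)) • casimir n := by
    rw [← Finset.sum_smul, ← geom_sum_eq (sub_ne_zero.mp hu)]
    congr 1
    refine Finset.sum_congr rfl fun k _ => ?_
    rw [zpow_neg, zpow_natCast, zpow_natCast, div_pow, div_eq_mul_inv]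
  rw [expansion, map_sub, map_add, map_sum]
  simp only [ev₂_map_mono]
  rw [hsum, rMatrix, r₀_eq, sub_div, sub_smul, zpow_zero, zpow_zero, mul_one, one_smul, mul_one_div]
  abel

/-- Truncation is harmless: against `z ^ l b` the partial sum has the contraction `rOp t (z ^ l b)`
when `l < K`, and contraction zero when `l ≥ K`, once `K` exceeds the degrees seen by `t`. -/
theorem contr_expansion_mem_range (hn : n ≠ 0) (t : Loop n ⊗[ℂ] Loop n) : ∃ K₀ : ℕ, ∀ K : ℕ,
    K₀ ≤ K → ∀ g, contr (Loop n) (loopForm n) g (expansion t K) ∈ LinearMap.range (rOp t) := by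
  obtain ⟨N, hN⟩ := exists_contrOp_mono_eq_zero t
  refine ⟨N + 1, fun K hK g => ?_⟩
  induction g using mono_induction with
  | hadd f g hf hg =>
    rw [contr_add]
    exact add_mem hf hg
  | hm l b =>
    have hsum : ∑ k ∈ Finset.range K, contr (Loop n) (loopForm n) (mono l b)
        (TensorProduct.map (mono (k : ℤ)) (mono (-k)) (casimir n)) =
          if 0 ≤ l ∧ l < K then mono l b else 0 := by
      simp only [contr_map_mono, contr_casimir hn]
      split_ifs with h
      · rw [Finset.sum_eq_single l.toNat]
        · rw [if_pos (by omega), Int.toNat_of_nonneg h.1]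
        · intro k _ hk
          rw [if_neg (by omega)]
        · intro hl
          rw [Finset.mem_range] at hl
          omega
      · refine Finset.sum_eq_zero fun k hk => ?_
        rw [Finset.mem_range] at hk
        rw [if_neg (by omega)]
    rw [expansion, map_sub, map_add, map_sum, hsum, contr_map_mono, contr_rConst hn, add_zero,
      ← contrOp_apply]
    rcases lt_or_ge l K with hl | hl
    · refine ⟨mono l b, ?_⟩
      rw [rOp_apply, stdOp_mono, rho, LinearMap.sub_apply, map_sub]
      rcases lt_trichotomy l 0 with h | rfl | h
      · rw [if_neg h.ne, if_neg h.not_ge, if_neg h.ne, if_neg (by omega)]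
        simp
      · rw [if_pos rfl, if_pos le_rfl, if_pos rfl, if_pos ⟨le_rfl, hl⟩, LinearMap.id_apply]
        abel
      · rw [if_neg h.ne', if_pos h.le, if_neg h.ne', if_pos ⟨h.le, hl⟩]
        simp
        abel
    · rw [if_neg (by omega), if_neg (by omega), hN l (by omega), add_zero, sub_zero]
      exact zero_mem _

/-- A skew-symmetric tensor that is polynomial in the first variable is polynomial. -/
theorem eq_map_polyIncl {u : Loop n ⊗[ℂ] Loop n} (hu : (truncLoop n).rTensor (Loop n) u = u)
    (hskew : flip (Loop n) u = -u) : TensorProduct.map (polyIncl n) (polyIncl n)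
      (TensorProduct.map (polyProj n) (polyProj n) u) = u := by
  have h1 : (truncLoop n).lTensor (Loop n) u = u := by
    have h : ∀ u : Loop n ⊗[ℂ] Loop n, (truncLoop n).lTensor (Loop n) (flip (Loop n) u) =
        flip (Loop n) ((truncLoop n).rTensor (Loop n) u) := by
      intro u
      induction u using TensorProduct.induction_on with
      | zero => simp
      | add u v hu hv => simp only [map_add, hu, hv]
      | tmul f g => rfl
    have := h u
    rwa [hu, hskew, map_neg, neg_inj] at this
  rw [← LinearMap.comp_apply, ← TensorProduct.map_comp]
  change TensorProduct.map (truncLoop n) (truncLoop n) u = u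
  rw [← LinearMap.lTensor_comp_rTensor, LinearMap.comp_apply, hu, h1]

/-- After gauging, the partial sum is polynomial in `x` by the choice of `P`. The tail returns to
its original form up to the divided difference of `C`, and this original tail recombines with the
expansion of `r₀`. -/
theorem exists_gauged_twist (hn : n ≠ 0) {t : Loop n ⊗[ℂ] Loop n}
    {P Q : Matrix (Fin n) (Fin n) ℂ[T;T⁻¹]}
    (hQP : Q * P = 1) (hPQ : P * Q = 1)
    (hpoly : ∀ g, ∃ c : Matrix (Fin n) (Fin n) ℂ[X], Q * mat n (rOp t g) * P = c.map toLaurent) :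
    ∃ u : Loop n ⊗[ℂ] Loop n, (truncLoop n).rTensor (Loop n) u = u ∧ ∀ x y : ℂˣ, x ≠ y →
      TensorProduct.map (conjEv hQP hPQ x).toLinearEquiv.toLinearMap
        (conjEv hQP hPQ y).toLinearEquiv.toLinearMap (rMatrix t x y) = rMatrix u x y := by
  obtain ⟨A, hA⟩ := exists_divided_difference_casimir hn hQP hPQ
  obtain ⟨B, hB⟩ := contr_expansion_mem_range hn t
  let K := max A B
  obtain ⟨q, hq, hq'⟩ := hA K (le_max_left A B)
  have hE := hB K (le_max_right A B)
  let E := TensorProduct.map (conjLoop P Q) (conjLoop P Q) (expansion t K)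
  have hEtrunc : (truncLoop n).rTensor (Loop n) E = E := by
    -- Only the first leg is conjugated here, so contractions of the second leg stay in the gauged
    -- range. Conjugating the second leg afterwards commutes with truncating the first.
    have h0 : (truncLoop n).rTensor (Loop n)
        ((conjLoop P Q).rTensor (Loop n) (expansion t K)) =
          (conjLoop P Q).rTensor (Loop n) (expansion t K) := by
      refine truncLoop_rTensor_eq_self hn fun g => ?_
      have h : ∀ u : Loop n ⊗[ℂ] Loop n, contr (Loop n) (loopForm n) g
          ((conjLoop P Q).rTensor (Loop n) u) =
            conjLoop P Q (contr (Loop n) (loopForm n) g u) := by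
        intro u
        induction u using TensorProduct.induction_on with
        | zero => simp
        | add u v hu hv => simp only [map_add, hu, hv]
        | tmul m y => simp
      rw [h]
      obtain ⟨g', hg'⟩ := hE g
      obtain ⟨c, hc⟩ := hpoly g'
      have : conjLoop P Q (contr (Loop n) (loopForm n) g (expansion t K)) =
          ofMat n (c.map toLaurent) := by
        rw [← hc, ← hg']
        rfl
      rw [this, ofMat_map_toLaurent, truncLoop_polyIncl]
    change (truncLoop n).rTensor (Loop n) (TensorProduct.map (conjLoop P Q) (conjLoop P Q)
      (expansion t K)) = TensorProduct.map (conjLoop P Q) (conjLoop P Q) (expansion t K)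
    rw [← LinearMap.lTensor_comp_rTensor, LinearMap.comp_apply, ← LinearMap.comp_apply,
      LinearMap.rTensor_comp_lTensor, ← LinearMap.lTensor_comp_rTensor, LinearMap.comp_apply, h0]
  -- Subtracting `expansion 0 K` turns the remaining tail `u ^ K / (u - 1) · C` back into `r₀`.
  refine ⟨E + q - (expansion 0 K), ?_, fun x y hxy => ?_⟩
  · rw [map_sub, map_add, hEtrunc, hq, expansion, add_zero, map_sub, map_sum,
      truncLoop_rTensor_map_mono le_rfl]
    congr 2
    exact Finset.sum_congr rfl fun k _ => truncLoop_rTensor_map_mono (Int.natCast_nonneg k) _ _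
  · have h0 := rMatrix_eq_expansion (n := n) 0 K hxy
    rw [rMatrix, map_zero, add_zero] at h0
    rw [rMatrix_eq_expansion t K hxy, map_add, map_smul, ← ev₂_map_conjLoop hQP hPQ, rMatrix, h0,
      map_sub, map_add, hq' x y hxy, smul_sub]
    abel

theorem exists_quasiTrigonometric (hn : n ≠ 0) {r : ℂˣ → ℂˣ → G n ⊗[ℂ] G n}
    (hr : IsIdTrigonometric r) : ∃ s : ℂˣ → ℂˣ → G n ⊗[ℂ] G n,
      IsQuasiTrigonometric s ∧ RegularlyEquivalent r s := by
  obtain ⟨t, ht, hrt⟩ := hr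
  obtain ⟨P, Q, hQP, hPQ, hpoly⟩ := exists_gauge hn ht
  obtain ⟨u, hu, hmap⟩ := exists_gauged_twist hn hQP hPQ hpoly
  let s : ℂˣ → ℂˣ → G n ⊗[ℂ] G n := fun x y =>
    TensorProduct.map (conjEv hQP hPQ x).toLinearEquiv.toLinearMap
      (conjEv hQP hPQ y).toLinearEquiv.toLinearMap (rMatrix t x y)
  have hskew : IsSkew s := map_isSkew (rMatrix_isSkew ht.1) _
  have hcybe : SolvesCYBE s := map_solvesCYBE (rMatrix_solvesCYBE hn ht)
    fun x => (conjEv hQP hPQ x).toLieHom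
  -- Both `s` and `r₀` are skew-symmetric off the diagonal, hence so are the values of `u`, and
  -- these determine `u`.
  have hflip : flip (Loop n) u = -u := by
    rw [eq_neg_iff_add_eq_zero, add_comm]
    refine eq_zero_of_ev₂ fun x y hxy => ?_
    have h := hskew x y hxy
    change s x y + flip (G n) (s y x) = 0 at h
    have h1 : s x y = rMatrix u x y := hmap x y hxy
    have h2 : s y x = rMatrix u y x := hmap y x hxy.symm
    rwa [h1, h2, rMatrix, rMatrix, map_add, add_add_add_comm, r₀_add_flip hxy, zero_add,
      ← ev₂_flip, ← map_add] at h
  refine ⟨s, ⟨hskew, hcybe, TensorProduct.map (polyProj n) (polyProj n) u, fun x y hxy => ?_⟩,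
    ⟨⟨conjEv hQP hPQ, fun a => ⟨conjLoop P Q (mono 0 a), fun z => ?_⟩⟩, fun x y hxy => ?_⟩⟩
  · rw [eq_map_polyIncl hu hflip]
    exact hmap x y hxy
  · rw [ev_conjLoop hQP hPQ, ev_mono, zpow_zero, one_smul]
  · rw [hrt x y hxy]

end Main
end SlLoop

end

theorem lemma4p9 (n : ℕ) (hn : 2 ≤ n)
    (r : ℂˣ → ℂˣ → SlLoop.G n ⊗[ℂ] SlLoop.G n) (hr : SlLoop.IsIdTrigonometric r) :
    ∃ s : ℂˣ → ℂˣ → SlLoop.G n ⊗[ℂ] SlLoop.G n,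
      SlLoop.IsQuasiTrigonometric s ∧ SlLoop.RegularlyEquivalent r s :=
  SlLoop.exists_quasiTrigonometric (by omega) hr
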